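/- Let $U=SU(2)$, let $K=SO(2)\subset U$ be the subgroup of matrices with real entries, let $m_U$, $m_K$ be the Haar probability measures of $U$ and $K$, and let $N_U(K)$ be the normalizer of $K$ in $U$. For $a\in U$ let $\mu_a$ be the normalized $K$-bi-invariant measure on the double coset $KaK$, i.e. the probability measure with $\int_U f\,d\mu_a=\int_K\int_K f(k_1ak_2)\,dm_K(k_1)\,dm_K(k_2)$ for all $f\in C(U)$, and for an integer $p\ge 1$ let $\mu_a^{(p)}$ be the convolution of $p$ copies of $\mu_a$. (i) For every $a\in U\setminus N_U(K)$ and every integer $p\geq 3$, the measure $\mu_a^{(p)}$ is absolutely continuous with respect to $m_U$ and its density $d\mu_a^{(p)}/dm_U$ lies in $L^2(U,m_U)$. (ii) For every $\theta\in(\pi/12,\,5\pi/12)$, the element $a_\theta=\mathrm{diag}(e^{i\theta},e^{-i\theta})$ is not in $N_U(K)$, the measure $\mu_{a_\theta}^{(2)}$ is absolutely continuous with respect to $m_U$, and its density $d\mu_{a_\theta}^{(2)}/dm_U$ is not in $L^2(U,m_U)$. (iii) Consequently the $L^1$/$L^2$ dichotomy fails for the compact symmetric space $SU(2)/SO(2)$: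 it is not true that for all $a\in U\setminus N_U(K)$ and all integers $p\ge1$, $\mu_a^{(p)}$ is absolutely continuous with respect to $m_U$ if and only if it is absolutely continuous with a density in $L^2(U,m_U)$. -/

import Mathlib

open MeasureTheory

namespace OrbitalSU2

/-- The group `SU(2)` with the topology inherited from the space of complex matrices. -/
abbrev SU2 : Type := ↥(Matrix.specialUnitaryGroup (Fin 2) ℂ)

/-- The Borel sigma-algebra of `SU(2)`. -/
noncomputable instance instMeasurableSpaceSU2 : MeasurableSpace SU2 := borel SU2

instance instBorelSpaceSU2 : BorelSpace SU2 := ⟨rfl⟩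

instance instIsTopologicalGroupSU2 : IsTopologicalGroup SU2 where
  continuous_mul := by
    refine Continuous.subtype_mk ?_ _
    exact (continuous_subtype_val.comp continuous_fst).mul
      (continuous_subtype_val.comp continuous_snd)
  continuous_inv := by
    refine Continuous.subtype_mk ?_ _
    exact continuous_star.comp continuous_subtype_val

instance instSecondCountableTopologySU2 : SecondCountableTopology SU2 :=
  haveI : SecondCountableTopology (Matrix (Fin 2) (Fin 2) ℂ) :=
    inferInstanceAs (SecondCountableTopology (Fin 2 → Fin 2 → ℂ))
  TopologicalSpace.Subtype.secondCountableTopology _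

instance instCompactSpaceSU2 : CompactSpace SU2 := by
  refine isCompact_iff_compactSpace.1 (?_ :
    IsCompact (Matrix.specialUnitaryGroup (Fin 2) ℂ : Set (Matrix (Fin 2) (Fin 2) ℂ)))
  have hc : IsClosed ((Matrix.specialUnitaryGroup (Fin 2) ℂ : Set (Matrix (Fin 2) (Fin 2) ℂ))) := by
    have h : (Matrix.specialUnitaryGroup (Fin 2) ℂ : Set (Matrix (Fin 2) (Fin 2) ℂ)) =
        {A | A * star A = 1} ∩ {A | A.det = 1} := by
      ext A
      simp only [SetLike.mem_coe, Matrix.mem_specialUnitaryGroup_iff,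
        Matrix.mem_unitaryGroup_iff, Set.mem_inter_iff, Set.mem_ofPred_eq]
    rw [h]
    exact (isClosed_eq (by fun_prop) continuous_const).inter
      (isClosed_eq (by fun_prop) continuous_const)
  have hK : IsCompact (Set.univ.pi fun _ : Fin 2 => Set.univ.pi fun _ : Fin 2 =>
      Metric.closedBall (0 : ℂ) 1) :=
    isCompact_univ_pi fun _ => isCompact_univ_pi fun _ => isCompact_closedBall 0 1
  refine hK.of_isClosed_subset hc fun A hA i _ j _ => ?_
  rw [mem_closedBall_zero_iff]
  exact entry_norm_bound_of_unitary (Matrix.specialUnitaryGroup_le_unitaryGroup hA) i j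

/-- `SO(2)` as a subgroup of `SU(2)`: the elements whose matrix is the complexification of a real
special orthogonal matrix. -/
def SO2 : Subgroup SU2 where
  carrier := {u | ∃ k ∈ Matrix.specialOrthogonalGroup (Fin 2) ℝ,
    (u : Matrix (Fin 2) (Fin 2) ℂ) = k.map (fun x : ℝ => (x : ℂ))}
  mul_mem' := by
    rintro u v ⟨k, hk, hu⟩ ⟨l, hl, hv⟩
    refine ⟨k * l, mul_mem hk hl, ?_⟩
    rw [Submonoid.coe_mul, hu, hv]
    exact (Matrix.map_mul (f := Complex.ofRealHom)).symm
  one_mem' := ⟨1, one_mem _, by simp⟩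
  inv_mem' := by
    rintro u ⟨k, hk, hu⟩
    refine ⟨k.transpose, ?_, ?_⟩
    · rw [Matrix.mem_specialOrthogonalGroup_fin_two_iff] at hk ⊢
      simp only [Matrix.transpose_apply]
      exact ⟨hk.1, by linarith [hk.2.1], by rw [← neg_sq (k 1 0), ← hk.2.1]; exact hk.2.2⟩
    · change star (u : Matrix (Fin 2) (Fin 2) ℂ) = _
      rw [hu]
      ext i j
      simp [Matrix.star_apply]

theorem isClosed_SO2 : IsClosed (SO2 : Set SU2) := by
  have h : (SO2 : Set SU2) = {u | ∀ i j, (u.1 i j).im = 0} := by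
    ext u
    constructor
    · rintro ⟨k, -, hu⟩ i j
      simp [hu]
    · intro hu
      replace hu : ∀ i j, (u.1 i j).im = 0 := hu
      have hre : ∀ i j, u.1 i j = ((u.1 i j).re : ℂ) := fun i j =>
        Complex.ext (by simp) (by simpa using hu i j)
      have heq : (u : Matrix (Fin 2) (Fin 2) ℂ) =
          (u.1.map Complex.re).map (fun x : ℝ => (x : ℂ)) := by
        ext i j
        simpa using hre i j
      refine ⟨u.1.map Complex.re, ?_, heq⟩
      rw [Matrix.mem_specialOrthogonalGroup_iff, Matrix.mem_orthogonalGroup_iff]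
      obtain ⟨h1, h2⟩ := Matrix.mem_specialUnitaryGroup_iff.1 u.2
      rw [Matrix.mem_unitaryGroup_iff] at h1
      constructor
      · ext i j
        have := congrArg Complex.re (congrFun (congrFun h1 i) j)
        simp only [Matrix.mul_apply, Matrix.star_apply, Fin.sum_univ_two, Complex.add_re,
          Complex.mul_re, RCLike.star_def, Complex.conj_re, Complex.conj_im, hu] at this
        simp only [Matrix.mul_apply, Matrix.map_apply, Matrix.transpose_apply, Fin.sum_univ_two]
        rw [Matrix.one_apply] at this ⊢
        split_ifs at this ⊢ <;> simpa using this
      · have := congrArg Complex.re h2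
        rw [Matrix.det_fin_two] at this ⊢
        simpa [hu] using this
  rw [h]
  simp only [Set.ofPred_forall]
  refine isClosed_iInter fun i => isClosed_iInter fun j => isClosed_eq ?_ continuous_const
  exact Complex.continuous_im.comp (continuous_subtype_val.matrix_elem i j)

instance instCompactSpaceSO2 : CompactSpace SO2 :=
  isCompact_iff_compactSpace.1 isClosed_SO2.isCompact

/-- The Haar probability measure of `SU(2)`. -/
noncomputable def haarU : Measure SU2 := Measure.haarMeasure ⊤

/-- The Haar probability measure of `SO(2)`. -/
noncomputable def haarK : Measure SO2 := Measure.haarMeasure ⊤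

/-- The normalized `SO(2)`-bi-invariant measure on the double coset of `a`: the image of the product
of the Haar probability measures under `(k₁, k₂) ↦ k₁ a k₂`. -/
noncomputable def orbitalMeasure (a : SU2) : Measure SU2 :=
  (haarK.prod haarK).map fun k : SO2 × SO2 => (k.1 : SU2) * a * (k.2 : SU2)

/-- The `p`-fold convolution power of a measure, for the convolution `Measure.mconv`. -/
noncomputable def convPow {G : Type*} [Monoid G] [MeasurableSpace G] (μ : Measure G) :
    ℕ → Measure G
  | 0 => Measure.dirac 1
  | p + 1 => (convPow μ p).mconv μ

/-- The Radon-Nikodym derivative with respect to the Haar measure of `SU(2)`, as a real function. -/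
noncomputable def density (ν : Measure SU2) (x : SU2) : ℝ := (ν.rnDeriv haarU x).toReal

/-- The diagonal matrix with entries `exp (iθ)` and `exp (-iθ)`. -/
noncomputable def diagElement (θ : ℝ) : SU2 :=
  ⟨!![Complex.exp (θ * Complex.I), 0; 0, Complex.exp (-(θ * Complex.I))], by
    rw [Matrix.mem_specialUnitaryGroup_iff, Matrix.mem_unitaryGroup_iff]
    constructor
    · ext i j
      fin_cases i <;> fin_cases j <;>
        simp [Matrix.mul_apply, Fin.sum_univ_two, Matrix.star_apply, ← Complex.exp_conj,
          ← Complex.exp_add]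
    · simp [Matrix.det_fin_two, ← Complex.exp_add]⟩

end OrbitalSU2

/-!
The double cosets of `K` in `U` are the level sets of a height function `U → [-1, 1]`: they are the
parallels of the sphere `U / K = S²`. By Archimedes' theorem the height of a Haar random element is
uniform, so a bi-invariant measure on `U` is governed by the law of its height. Convolution with
`μ_a` averages over the spherical circles of radius `arccos c`, where `c` is the height of `a`. This
averaging is diagonalised by the Legendre polynomials; by Laplace's integral the eigenvalue on
`P n` is `P n (c) = O(n ^ (-1/2))` for `|c| < 1`, that is, for `a` outside the normalizer of `K`.
Hence the squared Legendre coefficients of `μ_a ^ (p)` are `O(n ^ (1 - p))`, which is summable for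
`3 ≤ p`. For `p = 2` a circle meets the cap of measure `δ ^ 2` around one of its points in an arc of
length comparable to `δ`, and an `L²` density cannot put that much mass on such small caps.
-/

namespace OrbitalSU2

open ProbabilityTheory Polynomial

section Coordinates

theorem star_val_eq_adjugate (u : SU2) : star u.1 = u.1.adjugate := by
  obtain ⟨hu, hdet⟩ := Matrix.mem_specialUnitaryGroup_iff.1 u.2
  rw [Matrix.mem_unitaryGroup_iff] at hu
  calc star u.1 = (u.1.adjugate * u.1) * star u.1 := by
        rw [Matrix.adjugate_mul, hdet, one_smul, one_mul]
    _ = u.1.adjugate := by rw [mul_assoc, hu, mul_one]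

theorem val_one_one (u : SU2) : u.1 1 1 = star (u.1 0 0) := by
  simpa [Matrix.adjugate_fin_two, Matrix.star_apply] using
    congrArg (fun A => A 0 0) (star_val_eq_adjugate u).symm

theorem val_one_zero (u : SU2) : u.1 1 0 = -star (u.1 0 1) := by
  have h : star (u.1 0 1) = -u.1 1 0 := by
    simpa [Matrix.adjugate_fin_two, Matrix.star_apply] using
      congrArg (fun A => A 1 0) (star_val_eq_adjugate u)
  rw [h, neg_neg]

theorem ext_row_zero {u v : SU2} (h0 : u.1 0 0 = v.1 0 0) (h1 : u.1 0 1 = v.1 0 1) : u = v := by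
  refine Subtype.ext (Matrix.ext fun i j => ?_)
  fin_cases i <;> fin_cases j
  · exact h0
  · exact h1
  · exact (val_one_zero u).trans (h1 ▸ (val_one_zero v).symm)
  · exact (val_one_one u).trans (h0 ▸ (val_one_one v).symm)

theorem sum_sq_row_zero (u : SU2) :
    (u.1 0 0).re ^ 2 + (u.1 0 0).im ^ 2 + (u.1 0 1).re ^ 2 + (u.1 0 1).im ^ 2 = 1 := by
  have hdet := (Matrix.mem_specialUnitaryGroup_iff.1 u.2).2
  rw [Matrix.det_fin_two, val_one_one, val_one_zero] at hdet
  have hre := congrArg Complex.re hdet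
  simp only [RCLike.star_def, Complex.sub_re, Complex.mul_re, Complex.neg_re, Complex.neg_im,
    Complex.conj_re, Complex.conj_im, Complex.one_re] at hre
  linarith

theorem mul_val_zero_zero (u v : SU2) :
    (u * v).1 0 0 = u.1 0 0 * v.1 0 0 - u.1 0 1 * star (v.1 0 1) := by
  rw [Submonoid.coe_mul, Matrix.mul_apply, Fin.sum_univ_two, val_one_zero, mul_neg, sub_eq_add_neg]

theorem mul_val_zero_one (u v : SU2) :
    (u * v).1 0 1 = u.1 0 0 * v.1 0 1 + u.1 0 1 * star (v.1 0 0) := by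
  rw [Submonoid.coe_mul, Matrix.mul_apply, Fin.sum_univ_two, val_one_one]

/-- The coordinate on `SU(2)` that parametrizes the double cosets of `SO(2)`: under
`SU(2) / SO(2) ≃ S²`, `u ↦ u * uᵀ`, it is the third coordinate of the sphere. -/
noncomputable def height (u : SU2) : ℝ := (u.1 * u.1.transpose).trace.re / 2

theorem height_eq (u : SU2) :
    height u = (u.1 0 0).re ^ 2 - (u.1 0 0).im ^ 2 + (u.1 0 1).re ^ 2 - (u.1 0 1).im ^ 2 := by
  simp only [height, Matrix.trace_fin_two, Matrix.mul_apply, Matrix.transpose_apply,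
    Fin.sum_univ_two, val_one_zero, val_one_one, RCLike.star_def, Complex.add_re, Complex.mul_re,
    Complex.neg_re, Complex.neg_im, Complex.conj_re, Complex.conj_im]
  ring

theorem continuous_height : Continuous height := by
  have hval : Continuous fun u : SU2 => u.1 := continuous_subtype_val
  exact (Complex.continuous_re.comp
    (hval.matrix_mul hval.matrix_transpose).matrix_trace).div_const 2

theorem measurable_height : Measurable height := continuous_height.measurable

theorem height_mem_Icc (u : SU2) : height u ∈ Set.Icc (-1 : ℝ) 1 := by
  have hsum := sum_sq_row_zero u
  rw [height_eq]
  constructor <;> nlinarith [sq_nonneg (u.1 0 0).re, sq_nonneg (u.1 0 0).im,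
    sq_nonneg (u.1 0 1).re, sq_nonneg (u.1 0 1).im]

theorem height_one : height 1 = 1 := by simp [height]

theorem height_inv (u : SU2) : height u⁻¹ = height u := by
  have hinv : (u⁻¹).1 = u.1.adjugate := star_val_eq_adjugate u
  rw [height_eq, height_eq, hinv, Matrix.adjugate_fin_two]
  simp [val_one_one]

theorem coe_mul_transpose_coe (k : SO2) : (k : SU2).1 * (k : SU2).1.transpose = 1 := by
  obtain ⟨r, hr, hk⟩ := k.2
  rw [Matrix.mem_specialOrthogonalGroup_iff, Matrix.mem_orthogonalGroup_iff] at hr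
  rw [hk, ← Matrix.transpose_map]
  refine (Matrix.map_mul (f := Complex.ofRealHom)).symm.trans ?_
  rw [hr.1]
  simp

theorem height_mul_coe (u : SU2) (k : SO2) : height (u * k) = height u := by
  rw [height, height, Submonoid.coe_mul, Matrix.transpose_mul, ← mul_assoc, mul_assoc u.1,
    coe_mul_transpose_coe, mul_one]

theorem height_coe_mul (k : SO2) (u : SU2) : height (k * u) = height u := by
  rw [← height_inv, mul_inv_rev, ← Subgroup.coe_inv, height_mul_coe, height_inv]

end Coordinates

section PolarDecomposition

theorem map_ofReal_mem_specialUnitaryGroup {n : Type*} [Fintype n] [DecidableEq n]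
    {k : Matrix n n ℝ} (hk : k ∈ Matrix.specialOrthogonalGroup n ℝ) :
    k.map (fun x : ℝ => (x : ℂ)) ∈ Matrix.specialUnitaryGroup n ℂ := by
  rw [Matrix.mem_specialOrthogonalGroup_iff, Matrix.mem_orthogonalGroup_iff] at hk
  rw [Matrix.mem_specialUnitaryGroup_iff, Matrix.mem_unitaryGroup_iff]
  constructor
  · have hstar : star (k.map fun x : ℝ => (x : ℂ)) =
        k.transpose.map fun x : ℝ => (x : ℂ) := by
      ext i j
      simp [Matrix.star_apply]
    rw [hstar]
    refine (Matrix.map_mul (f := Complex.ofRealHom)).symm.trans ?_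
    rw [hk.1]
    simp
  · have hdet := (Complex.ofRealHom.map_det k).symm
    rwa [hk.2, map_one] at hdet

/-- The matrix of the rotation with angle `t`, oriented so that its first row is
`(cos t, sin t)`. -/
noncomputable def rotMatrix (t : ℝ) : Matrix (Fin 2) (Fin 2) ℝ :=
  !![Real.cos t, Real.sin t; -Real.sin t, Real.cos t]

theorem rotMatrix_mem (t : ℝ) : rotMatrix t ∈ Matrix.specialOrthogonalGroup (Fin 2) ℝ := by
  simp [rotMatrix, Matrix.mem_specialOrthogonalGroup_fin_two_iff]

/-- The rotation with angle `t` as an element of `SO(2)`; it parametrizes the Haar measure. -/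
noncomputable def rot (t : ℝ) : SO2 :=
  ⟨⟨(rotMatrix t).map fun x : ℝ => (x : ℂ), map_ofReal_mem_specialUnitaryGroup (rotMatrix_mem t)⟩,
    rotMatrix t, rotMatrix_mem t, rfl⟩

theorem rot_val_zero_zero (t : ℝ) : (rot t : SU2).1 0 0 = Real.cos t := rfl

theorem rot_val_zero_one (t : ℝ) : (rot t : SU2).1 0 1 = Real.sin t := rfl

theorem rot_add (s t : ℝ) : rot (s + t) = rot s * rot t := by
  refine Subtype.ext (ext_row_zero ?_ ?_)
  · rw [Subgroup.coe_mul, mul_val_zero_zero]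
    simp only [rot_val_zero_zero, rot_val_zero_one, Real.cos_add]
    simp [-Complex.ofReal_cos, -Complex.ofReal_sin]
  · rw [Subgroup.coe_mul, mul_val_zero_one]
    simp only [rot_val_zero_zero, rot_val_zero_one, Real.sin_add]
    simp [-Complex.ofReal_cos, -Complex.ofReal_sin, add_comm]

theorem periodic_rot : Function.Periodic rot (2 * Real.pi) := fun t => by
  have hmat : rotMatrix (t + 2 * Real.pi) = rotMatrix t := by simp [rotMatrix]
  simp only [rot, hmat]

theorem continuous_rot : Continuous rot := by
  refine Continuous.subtype_mk (Continuous.subtype_mk (continuous_matrix fun i j => ?_) _) _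
  refine Complex.continuous_ofReal.comp ?_
  fin_cases i <;> fin_cases j
  exacts [Real.continuous_cos, Real.continuous_sin, Real.continuous_sin.neg, Real.continuous_cos]

theorem exists_eq_mul_cos_sin {x y r : ℝ} (hr : 0 ≤ r) (h : x ^ 2 + y ^ 2 = r ^ 2) :
    ∃ t : ℝ, x = r * Real.cos t ∧ y = r * Real.sin t := by
  have hnorm : ‖(⟨x, y⟩ : ℂ)‖ = r := by
    rw [Complex.norm_eq_sqrt_sq_add_sq, h, Real.sqrt_sq hr]
  refine ⟨Complex.arg ⟨x, y⟩, ?_⟩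
  rw [← hnorm]
  exact ⟨(Complex.norm_mul_cos_arg ⟨x, y⟩).symm, (Complex.norm_mul_sin_arg ⟨x, y⟩).symm⟩

theorem exists_eq_rot_of_im_eq_zero {u : SU2} (h0 : (u.1 0 0).im = 0) (h1 : (u.1 0 1).im = 0) :
    ∃ t, u = rot t := by
  obtain ⟨t, hcos, hsin⟩ := exists_eq_mul_cos_sin (x := (u.1 0 0).re) (y := (u.1 0 1).re)
    zero_le_one (by linarith [sum_sq_row_zero u, sq_eq_zero_iff.2 h0, sq_eq_zero_iff.2 h1])
  rw [one_mul] at hcos hsin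
  refine ⟨t, ext_row_zero (Complex.ext ?_ ?_) (Complex.ext ?_ ?_)⟩ <;>
    simp only [rot_val_zero_zero, rot_val_zero_one, Complex.ofReal_re, Complex.ofReal_im] <;>
    assumption

theorem mem_SO2_iff_height_eq_one {u : SU2} : u ∈ SO2 ↔ height u = 1 := by
  constructor
  · intro hu
    simpa [height_one] using height_mul_coe 1 ⟨u, hu⟩
  · intro hu
    rw [height_eq] at hu
    have hsum := sum_sq_row_zero u
    obtain ⟨t, rfl⟩ := exists_eq_rot_of_im_eq_zero (u := u)
      (pow_eq_zero_iff two_ne_zero |>.1 <| by nlinarith [sq_nonneg (u.1 0 0).im])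
      (pow_eq_zero_iff two_ne_zero |>.1 <| by nlinarith [sq_nonneg (u.1 0 1).im])
    exact (rot t).2

theorem rot_surjective : Function.Surjective rot := by
  rintro ⟨u, k, hk, hu⟩
  obtain ⟨t, ht⟩ := exists_eq_rot_of_im_eq_zero (u := u) (by simp [hu]) (by simp [hu])
  exact ⟨t, Subtype.ext ht.symm⟩

theorem diagElement_val_zero_zero (θ : ℝ) :
    (diagElement θ).1 0 0 = ⟨Real.cos θ, Real.sin θ⟩ := by
  change Complex.exp (θ * Complex.I) = _
  rw [Complex.exp_mul_I]
  apply Complex.ext <;> simp [Complex.cos_ofReal_re, Complex.sin_ofReal_re]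

theorem diagElement_val_zero_one (θ : ℝ) : (diagElement θ).1 0 1 = 0 := rfl

theorem inv_diagElement (θ : ℝ) : (diagElement θ)⁻¹ = diagElement (-θ) := by
  refine inv_eq_of_mul_eq_one_right (ext_row_zero ?_ ?_)
  · rw [mul_val_zero_zero, diagElement_val_zero_zero, diagElement_val_zero_zero,
      diagElement_val_zero_one]
    apply Complex.ext <;> simp [← sq, mul_comm]
  · rw [mul_val_zero_one, diagElement_val_zero_one, diagElement_val_zero_one]
    simp

theorem height_diagElement (θ : ℝ) : height (diagElement θ) = Real.cos (2 * θ) := by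
  rw [height_eq, diagElement_val_zero_zero, diagElement_val_zero_one, Real.cos_two_mul']
  simp

theorem height_diagElement_mul_rot_mul_diagElement (θ t φ : ℝ) :
    height (diagElement θ * rot t * diagElement φ) =
      Real.cos (2 * θ) * Real.cos (2 * φ)
        - Real.sin (2 * θ) * Real.sin (2 * φ) * Real.cos (2 * t) := by
  have h00 : (diagElement θ * rot t * diagElement φ).1 0 0 =
      ⟨Real.cos (θ + φ) * Real.cos t, Real.sin (θ + φ) * Real.cos t⟩ := by
    simp only [mul_val_zero_zero, mul_val_zero_one, diagElement_val_zero_zero,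
      diagElement_val_zero_one, rot_val_zero_zero, rot_val_zero_one, Real.cos_add, Real.sin_add]
    apply Complex.ext <;> simp [-Complex.ofReal_cos, -Complex.ofReal_sin] <;> ring
  have h01 : (diagElement θ * rot t * diagElement φ).1 0 1 =
      ⟨Real.cos (θ - φ) * Real.sin t, Real.sin (θ - φ) * Real.sin t⟩ := by
    simp only [mul_val_zero_zero, mul_val_zero_one, diagElement_val_zero_zero,
      diagElement_val_zero_one, rot_val_zero_zero, rot_val_zero_one, Real.cos_sub, Real.sin_sub]
    apply Complex.ext <;> simp [-Complex.ofReal_cos, -Complex.ofReal_sin] <;> ring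
  calc height (diagElement θ * rot t * diagElement φ)
      = Real.cos (2 * θ + 2 * φ) * Real.cos t ^ 2 + Real.cos (2 * θ - 2 * φ) * Real.sin t ^ 2 := by
        rw [height_eq, h00, h01, ← mul_add, ← mul_sub, Real.cos_two_mul', Real.cos_two_mul']
        ring
    _ = _ := by
        rw [Real.cos_add, Real.cos_sub, Real.cos_two_mul' t]
        linear_combination
          Real.cos (2 * θ) * Real.cos (2 * φ) * Real.cos_sq_add_sin_sq t

/-- The diagonal element of height `t`, a section of `height` over `[-1, 1]`. -/
noncomputable def polarSection (t : ℝ) : SU2 := diagElement (Real.arccos t / 2)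

theorem continuous_polarSection : Continuous polarSection := by
  have hangle : Continuous fun t => ((Real.arccos t / 2 : ℝ) : ℂ) :=
    Complex.continuous_ofReal.comp (Real.continuous_arccos.div_const 2)
  refine Continuous.subtype_mk (continuous_matrix fun i j => ?_) _
  fin_cases i <;> fin_cases j
  exacts [(hangle.mul_const _).cexp, continuous_const, continuous_const,
    (hangle.mul_const _).neg.cexp]

theorem rot_mul_diagElement_mul_rot_val (α θ β : ℝ) :
    (rot α * diagElement θ * rot β : SU2).1 0 0 =
        ⟨Real.cos θ * Real.cos (α + β), Real.sin θ * Real.cos (β - α)⟩ ∧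
      (rot α * diagElement θ * rot β : SU2).1 0 1 =
        ⟨Real.cos θ * Real.sin (α + β), Real.sin θ * Real.sin (β - α)⟩ := by
  simp only [mul_val_zero_zero, mul_val_zero_one, diagElement_val_zero_zero,
    diagElement_val_zero_one, rot_val_zero_zero, rot_val_zero_one, Real.cos_add, Real.sin_add,
    Real.cos_sub, Real.sin_sub]
  constructor <;> apply Complex.ext <;>
    simp [-Complex.ofReal_cos, -Complex.ofReal_sin] <;> ring

theorem exists_eq_mul_polarSection_mul (u : SU2) :
    ∃ k l : SO2, u = k * polarSection (height u) * l := by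
  set θ := Real.arccos (height u) / 2
  have hcos : Real.cos (2 * θ) = height u := by
    rw [mul_div_cancel₀ _ two_ne_zero, Real.cos_arccos (height_mem_Icc u).1 (height_mem_Icc u).2]
  have hsum := sum_sq_row_zero u
  have hθ : 0 ≤ θ := div_nonneg (Real.arccos_nonneg _) two_pos.le
  have hθ' : θ ≤ Real.pi / 2 := div_le_div_of_nonneg_right (Real.arccos_le_pi _) two_pos.le
  obtain ⟨p, h00re, h01re⟩ := exists_eq_mul_cos_sin (x := (u.1 0 0).re) (y := (u.1 0 1).re)
    (Real.cos_nonneg_of_neg_pi_div_two_le_of_le (by linarith [Real.pi_pos]) hθ')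
    (by rw [Real.cos_two_mul, height_eq] at hcos; linarith)
  obtain ⟨q, h00im, h01im⟩ := exists_eq_mul_cos_sin (x := (u.1 0 0).im) (y := (u.1 0 1).im)
    (Real.sin_nonneg_of_nonneg_of_le_pi hθ (by linarith [Real.pi_pos]))
    (by rw [Real.cos_two_mul, height_eq] at hcos; rw [Real.sin_sq]; linarith)
  obtain ⟨h00, h01⟩ := rot_mul_diagElement_mul_rot_val ((p - q) / 2) θ ((p + q) / 2)
  rw [show (p - q) / 2 + (p + q) / 2 = p by ring, show (p + q) / 2 - (p - q) / 2 = q by ring]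
    at h00 h01
  exact ⟨rot ((p - q) / 2), rot ((p + q) / 2), ext_row_zero
    (h00 ▸ Complex.ext h00re h00im) (h01 ▸ Complex.ext h01re h01im)⟩

theorem height_diagElement_mul_rot_mul_inv (θ t : ℝ) :
    height (diagElement θ * rot t * (diagElement θ)⁻¹) =
      Real.cos (2 * θ) ^ 2 + Real.sin (2 * θ) ^ 2 * Real.cos (2 * t) := by
  rw [inv_diagElement, height_diagElement_mul_rot_mul_diagElement, mul_neg, Real.cos_neg,
    Real.sin_neg]
  ring

theorem diagElement_mem_normalizer_SO2_iff {θ : ℝ} :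
    diagElement θ ∈ Subgroup.normalizer (SO2 : Set SU2) ↔ Real.sin (2 * θ) = 0 := by
  rw [Subgroup.mem_normalizer_iff]
  constructor
  · intro h
    have hconj := mem_SO2_iff_height_eq_one.1 ((h (rot (Real.pi / 2))).1 (rot _).2)
    rw [height_diagElement_mul_rot_mul_inv, mul_div_cancel₀ _ two_ne_zero, Real.cos_pi] at hconj
    refine pow_eq_zero_iff two_ne_zero |>.1 ?_
    linarith [Real.cos_sq_add_sin_sq (2 * θ)]
  · intro h
    have conj_mem : ∀ φ, Real.sin (2 * φ) = 0 → ∀ k ∈ SO2,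
        diagElement φ * k * (diagElement φ)⁻¹ ∈ SO2 := by
      intro φ hφ k hk
      obtain ⟨t, ht⟩ := rot_surjective ⟨k, hk⟩
      obtain rfl : (rot t : SU2) = k := congrArg Subtype.val ht
      rw [mem_SO2_iff_height_eq_one, height_diagElement_mul_rot_mul_inv, hφ, Real.cos_sq', hφ]
      ring
    refine fun g => ⟨conj_mem θ h g, fun hg => ?_⟩
    simpa [← inv_diagElement, mul_assoc] using conj_mem (-θ) (by simp [h]) _ hg

theorem mem_normalizer_SO2_iff {a : SU2} :
    a ∈ Subgroup.normalizer (SO2 : Set SU2) ↔ height a ^ 2 = 1 := by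
  obtain ⟨k, l, h⟩ := exists_eq_mul_polarSection_mul a
  rw [h, Subgroup.mul_mem_cancel_right _ (Subgroup.le_normalizer l.2),
    Subgroup.mul_mem_cancel_left _ (Subgroup.le_normalizer k.2), height_mul_coe, height_coe_mul,
    polarSection, diagElement_mem_normalizer_SO2_iff, height_diagElement, Real.cos_sq', sub_eq_self,
    sq_eq_zero_iff]

theorem sq_height_lt_one {a : SU2} (ha : a ∉ Subgroup.normalizer (SO2 : Set SU2)) :
    height a ^ 2 < 1 :=
  lt_of_le_of_ne ((sq_le_one_iff_abs_le_one _).2 (abs_le.2 (height_mem_Icc a)))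
    (mem_normalizer_SO2_iff.not.1 ha)

end PolarDecomposition

section Generalities

variable {α β γ : Type*} [MeasurableSpace α] [MeasurableSpace β] [MeasurableSpace γ]

theorem measurable_map_of_uncurry {f : α → β → γ} (hf : Measurable (Function.uncurry f))
    (μ : Measure β) [SFinite μ] : Measurable fun a => μ.map (f a) := by
  have hcomp : (fun a => μ.map (f a)) = fun a => (μ.map (Prod.mk a)).map (Function.uncurry f) :=
    funext fun a => (Measure.map_map hf measurable_prodMk_left).symm
  rw [hcomp]
  exact (Measure.measurable_map _ hf).comp Measurable.map_prodMk_left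

theorem map_withDensity_comp {μ : Measure α} {ν : Measure β} {f : α → β}
    (hf : MeasurePreserving f μ ν) {g : β → ENNReal} (hg : Measurable g) :
    (μ.withDensity (g ∘ f)).map f = ν.withDensity g := by
  ext s hs
  rw [Measure.map_apply hf.measurable hs, withDensity_apply _ (hf.measurable hs),
    withDensity_apply _ hs]
  exact hf.setLIntegral_comp_preimage hs hg

theorem integral_bind_kernel {E : Type*} [NormedAddCommGroup E] [NormedSpace ℝ E] {μ : Measure α}
    [SFinite μ] {κ : Kernel α β} [IsSFiniteKernel κ] {f : β → E}
    (hf : Integrable f (μ.bind κ)) : ∫ y, f y ∂μ.bind κ = ∫ x, ∫ y, f y ∂κ x ∂μ := by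
  rw [Measure.comp_eq_comp_const_apply] at hf ⊢
  rw [Kernel.integral_comp hf, Kernel.const_apply]

theorem map_swap_compProd_of_isReversible {π : Measure α} [IsFiniteMeasure π] {κ : Kernel α α}
    [IsFiniteKernel κ] (h : κ.IsReversible π) : (π ⊗ₘ κ).map Prod.swap = π ⊗ₘ κ := by
  refine Measure.ext_prod fun {A B} hA hB => ?_
  rw [Measure.map_apply measurable_swap (hA.prod hB), Set.preimage_swap_prod,
    Measure.compProd_apply_prod hB hA, Measure.compProd_apply_prod hA hB, h hA hB]

theorem integral_mul_integral_comm_of_isReversible {π : Measure α} [IsFiniteMeasure π]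
    {κ : Kernel α α} [IsFiniteKernel κ] (h : κ.IsReversible π) {f g : α → ℝ}
    (hfg : Integrable (fun q : α × α => f q.1 * g q.2) (π ⊗ₘ κ)) :
    ∫ x, f x * ∫ y, g y ∂κ x ∂π = ∫ x, (∫ y, f y ∂κ x) * g x ∂π := by
  have hswap : MeasurePreserving Prod.swap (π ⊗ₘ κ) (π ⊗ₘ κ) :=
    ⟨measurable_swap, map_swap_compProd_of_isReversible h⟩
  have hgf : Integrable (fun q : α × α => f q.2 * g q.1) (π ⊗ₘ κ) :=
    hswap.integrable_comp_of_integrable hfg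
  calc ∫ x, f x * ∫ y, g y ∂κ x ∂π = ∫ q, f q.1 * g q.2 ∂(π ⊗ₘ κ) := by
        rw [Measure.integral_compProd hfg]
        simp_rw [integral_const_mul]
    _ = ∫ q, f q.2 * g q.1 ∂(π ⊗ₘ κ) :=
        (hswap.integral_comp' (f := MeasurableEquiv.prodComm)
          (fun q : α × α => f q.1 * g q.2)).symm
    _ = _ := by
        rw [Measure.integral_compProd hgf]
        simp_rw [integral_mul_const]

theorem integrable_of_continuous_of_ae_mem {X E : Type*} [TopologicalSpace X]
    [TopologicalSpace.PseudoMetrizableSpace X] [T2Space X] [MeasurableSpace X]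
    [OpensMeasurableSpace X] [NormedAddCommGroup E]
    {μ : Measure X} [IsFiniteMeasure μ] {f : X → E} (hf : Continuous f) {K : Set X}
    (hK : IsCompact K) (hμ : ∀ᵐ x ∂μ, x ∈ K) : Integrable f μ := by
  rw [← Measure.restrict_eq_self_of_ae_mem hμ]
  exact hf.continuousOn.integrableOn_compact hK

end Generalities

section Haar

theorem isMulRightInvariant_of_isProbabilityMeasure {G : Type*} [Group G] [TopologicalSpace G]
    [IsTopologicalGroup G] [LocallyCompactSpace G] [MeasurableSpace G] [BorelSpace G]
    (μ : Measure G) [μ.IsHaarMeasure] [IsProbabilityMeasure μ] : μ.IsMulRightInvariant := by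
  refine ⟨fun g => ?_⟩
  have : IsProbabilityMeasure (μ.map (· * g)) :=
    Measure.isProbabilityMeasure_map (measurable_mul_const g).aemeasurable
  exact Measure.isHaarMeasure_eq_of_isProbabilityMeasure _ _

instance : SecondCountableTopology SO2 := TopologicalSpace.Subtype.secondCountableTopology _

instance : haarU.IsHaarMeasure := by unfold haarU; infer_instance

instance : haarK.IsHaarMeasure := by unfold haarK; infer_instance

instance : IsProbabilityMeasure haarU := ⟨Measure.haarMeasure_self⟩

instance : IsProbabilityMeasure haarK := ⟨Measure.haarMeasure_self⟩

instance : haarU.IsMulRightInvariant := isMulRightInvariant_of_isProbabilityMeasure _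

instance : haarK.IsMulRightInvariant := isMulRightInvariant_of_isProbabilityMeasure _

/-- The uniform probability measure on the angles in `(0, 2π]`. -/
noncomputable def angleMeasure : Measure ℝ :=
  ENNReal.ofReal (2 * Real.pi)⁻¹ • volume.restrict (Set.Ioc 0 (2 * Real.pi))

instance : IsProbabilityMeasure angleMeasure := ⟨by
  have := Real.pi_pos
  rw [angleMeasure, Measure.smul_apply, Measure.restrict_apply_univ, Real.volume_Ioc, smul_eq_mul,
    ← ENNReal.ofReal_mul (by positivity), sub_zero, inv_mul_cancel₀ (by positivity),
    ENNReal.ofReal_one]⟩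

theorem integral_angleMeasure {E : Type*} [NormedAddCommGroup E] [NormedSpace ℝ E] (f : ℝ → E) :
    ∫ t, f t ∂angleMeasure = (2 * Real.pi)⁻¹ • ∫ t in (0 : ℝ)..2 * Real.pi, f t := by
  have := Real.pi_pos
  rw [angleMeasure, integral_smul_measure, intervalIntegral.integral_of_le (by positivity),
    ENNReal.toReal_ofReal (by positivity)]

theorem integral_angleMeasure_add {E : Type*} [NormedAddCommGroup E] [NormedSpace ℝ E] {f : ℝ → E}
    (hf : Function.Periodic f (2 * Real.pi)) (s : ℝ) :
    ∫ t, f (t + s) ∂angleMeasure = ∫ t, f t ∂angleMeasure := by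
  rw [integral_angleMeasure, integral_angleMeasure, intervalIntegral.integral_comp_add_right,
    zero_add, add_comm, hf.intervalIntegral_add_eq s 0, zero_add]

theorem map_rot_angleMeasure : angleMeasure.map rot = haarK := by
  let _ : MetricSpace SO2 := TopologicalSpace.metrizableSpaceMetric SO2
  have hrot : AEMeasurable rot angleMeasure := continuous_rot.aemeasurable
  have : IsProbabilityMeasure (angleMeasure.map rot) := Measure.isProbabilityMeasure_map hrot
  refine ext_of_forall_integral_eq_of_IsFiniteMeasure fun f => ?_
  have hmul : Continuous fun q : ℝ × SO2 => rot q.1 * q.2 :=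
    (continuous_rot.comp continuous_fst).mul continuous_snd
  have hint : Integrable (fun q : ℝ × SO2 => f (rot q.1 * q.2)) (angleMeasure.prod haarK) :=
    (f.compContinuous ⟨_, hmul⟩).integrable _
  have htranslate (k : SO2) :
      ∫ t, f (rot t * k) ∂angleMeasure = ∫ t, f (rot t) ∂angleMeasure := by
    obtain ⟨s, rfl⟩ := rot_surjective k
    simp_rw [← rot_add]
    exact integral_angleMeasure_add (f := fun t => f (rot t)) (periodic_rot.comp f) s
  calc ∫ k, f k ∂angleMeasure.map rot
      = ∫ t, f (rot t) ∂angleMeasure := integral_map hrot f.continuous.aestronglyMeasurable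
    _ = ∫ k, ∫ t, f (rot t * k) ∂angleMeasure ∂haarK := by
        simp only [htranslate, integral_const, probReal_univ, one_smul]
    _ = ∫ t, ∫ k, f (rot t * k) ∂haarK ∂angleMeasure := (integral_integral_swap hint).symm
    _ = ∫ k, f k ∂haarK := by
        simp only [integral_mul_left_eq_self (μ := haarK) (fun k => f k), integral_const,
          probReal_univ, one_smul]

end Haar

section OrbitalMeasure

theorem measurable_orbit (a : SU2) :
    Measurable fun k : SO2 × SO2 => (k.1 : SU2) * a * (k.2 : SU2) := by
  fun_prop

instance (a : SU2) : IsProbabilityMeasure (orbitalMeasure a) :=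
  Measure.isProbabilityMeasure_map (measurable_orbit a).aemeasurable

theorem measurable_orbitalMeasure : Measurable orbitalMeasure :=
  measurable_map_of_uncurry (by unfold Function.uncurry; fun_prop) _

theorem orbitalMeasure_mul_mul (a : SU2) (k l : SO2) :
    orbitalMeasure (k * a * l) = orbitalMeasure a := by
  have h : MeasurePreserving (Prod.map (· * k) (l * ·)) (haarK.prod haarK) (haarK.prod haarK) :=
    (measurePreserving_mul_right haarK k).prod (measurePreserving_mul_left haarK l)
  conv_rhs => rw [orbitalMeasure, ← h.map_eq, Measure.map_map (measurable_orbit a) h.measurable]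
  simp only [orbitalMeasure, Function.comp_def, Prod.map, Subgroup.coe_mul, mul_assoc]

theorem orbitalMeasure_polarSection (a : SU2) :
    orbitalMeasure (polarSection (height a)) = orbitalMeasure a := by
  obtain ⟨k, l, h⟩ := exists_eq_mul_polarSection_mul a
  conv_rhs => rw [h, orbitalMeasure_mul_mul]

theorem map_height_orbitalMeasure (a : SU2) :
    (orbitalMeasure a).map height = Measure.dirac (height a) := by
  rw [orbitalMeasure, Measure.map_map measurable_height (measurable_orbit a)]
  simp only [Function.comp_def, height_mul_coe, height_coe_mul]
  rw [Measure.map_const, measure_univ, one_smul]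

/-- Invariance of a measure on `SU(2)` under left and right translations by `SO(2)`. -/
def IsBiInvariant (ν : Measure SU2) : Prop :=
  ∀ k l : SO2, ν.map (fun u => (k : SU2) * u * (l : SU2)) = ν

theorem IsBiInvariant.measurePreserving {ν : Measure SU2} (hν : IsBiInvariant ν) (k l : SO2) :
    MeasurePreserving (fun u => (k : SU2) * u * (l : SU2)) ν ν :=
  ⟨by fun_prop, hν k l⟩

theorem isBiInvariant_haarU : IsBiInvariant haarU := fun k l =>
  ((measurePreserving_mul_right haarU (l : SU2)).comp
    (measurePreserving_mul_left haarU (k : SU2))).map_eq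

theorem isBiInvariant_orbitalMeasure (a : SU2) : IsBiInvariant (orbitalMeasure a) := by
  intro k l
  have h : MeasurePreserving (Prod.map (k * ·) (· * l)) (haarK.prod haarK) (haarK.prod haarK) :=
    (measurePreserving_mul_left haarK k).prod (measurePreserving_mul_right haarK l)
  conv_rhs => rw [orbitalMeasure, ← h.map_eq, Measure.map_map (measurable_orbit a) h.measurable]
  rw [orbitalMeasure, Measure.map_map (by fun_prop) (measurable_orbit a)]
  simp only [Function.comp_def, Prod.map, Subgroup.coe_mul, mul_assoc]

theorem IsBiInvariant.mconv {ν ρ : Measure SU2} [SFinite ν] [SFinite ρ] (hν : IsBiInvariant ν)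
    (hρ : IsBiInvariant ρ) : IsBiInvariant (ν.mconv ρ) := by
  intro k l
  have hprod := (hν.measurePreserving k 1).prod (hρ.measurePreserving 1 l)
  conv_rhs => rw [Measure.mconv, ← hprod.map_eq, Measure.map_map measurable_mul hprod.measurable]
  rw [Measure.mconv, Measure.map_map (by fun_prop) measurable_mul]
  simp only [Function.comp_def, Prod.map, Subgroup.coe_one, one_mul, mul_one, mul_assoc]

theorem IsBiInvariant.map_inv {ν : Measure SU2} (hν : IsBiInvariant ν) :
    IsBiInvariant (ν.map (·⁻¹)) := by
  intro k l
  conv_rhs => rw [← hν l⁻¹ k⁻¹, Measure.map_map measurable_inv (by fun_prop)]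
  rw [Measure.map_map (by fun_prop) measurable_inv]
  simp only [Function.comp_def, mul_inv_rev, Subgroup.coe_inv, inv_inv, mul_assoc]

theorem IsBiInvariant.withDensity_comp_height {ν : Measure SU2} (hν : IsBiInvariant ν)
    {g : ℝ → ENNReal} (hg : Measurable g) : IsBiInvariant (ν.withDensity (g ∘ height)) := by
  intro k l
  have hcomp : g ∘ height = (g ∘ height) ∘ fun u : SU2 => (k : SU2) * u * (l : SU2) := by
    simp only [Function.comp_def, height_mul_coe, height_coe_mul]
  conv_lhs => rw [hcomp]
  exact map_withDensity_comp (hν.measurePreserving k l) (hg.comp measurable_height)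

instance (μ : Measure SU2) [IsProbabilityMeasure μ] (p : ℕ) :
    IsProbabilityMeasure (convPow μ p) := by
  induction p with
  | zero => unfold convPow; infer_instance
  | succ p ih => unfold convPow; infer_instance

theorem convPow_one {G : Type*} [Monoid G] [MeasurableSpace G] [MeasurableMul₂ G] (μ : Measure G)
    [SFinite μ] : convPow μ 1 = μ :=
  Measure.dirac_one_mconv μ

theorem isBiInvariant_convPow (a : SU2) {p : ℕ} (hp : 1 ≤ p) :
    IsBiInvariant (convPow (orbitalMeasure a) p) := by
  induction p, hp using Nat.le_induction with
  | base => rw [convPow_one]; exact isBiInvariant_orbitalMeasure a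
  | succ p _ ih => exact ih.mconv (isBiInvariant_orbitalMeasure a)

theorem IsBiInvariant.bind_orbitalMeasure {ν : Measure SU2} [SFinite ν] (hν : IsBiInvariant ν) :
    ν.bind orbitalMeasure = ν := by
  ext s hs
  have hmeas : Measurable fun q : SU2 × SO2 × SO2 => s.indicator (1 : SU2 → ENNReal)
      (q.2.1 * q.1 * q.2.2) := (measurable_one.indicator hs).comp (by fun_prop)
  have htranslate (k : SO2 × SO2) :
      ∫⁻ u, s.indicator 1 ((k.1 : SU2) * u * (k.2 : SU2)) ∂ν = ν s := by
    rw [(hν.measurePreserving k.1 k.2).lintegral_comp (measurable_one.indicator hs),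
      lintegral_indicator_one hs]
  calc ν.bind orbitalMeasure s
      = ∫⁻ u, ∫⁻ k : SO2 × SO2, s.indicator 1 (k.1 * u * k.2) ∂(haarK.prod haarK) ∂ν := by
        rw [Measure.bind_apply hs measurable_orbitalMeasure.aemeasurable]
        refine lintegral_congr fun u => ?_
        rw [← lintegral_indicator_one hs, orbitalMeasure,
          lintegral_map (measurable_one.indicator hs) (measurable_orbit u)]
    _ = ∫⁻ k : SO2 × SO2, ∫⁻ u, s.indicator 1 (k.1 * u * k.2) ∂ν ∂(haarK.prod haarK) :=
        lintegral_lintegral_swap hmeas.aemeasurable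
    _ = ν s := by
        simp only [htranslate, lintegral_const, measure_univ, mul_one]

theorem IsBiInvariant.ext {ν ρ : Measure SU2} [SFinite ν] [SFinite ρ] (hν : IsBiInvariant ν)
    (hρ : IsBiInvariant ρ) (h : ν.map height = ρ.map height) : ν = ρ := by
  have apply_eq : ∀ (σ : Measure SU2) [SFinite σ], IsBiInvariant σ → ∀ s, MeasurableSet s →
      σ s = ∫⁻ t, orbitalMeasure (polarSection t) s ∂σ.map height := by
    intro σ _ hσ s hs
    have hmeas : Measurable fun t => orbitalMeasure (polarSection t) s :=
      (Measure.measurable_coe hs).comp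
        (measurable_orbitalMeasure.comp continuous_polarSection.measurable)
    conv_lhs => rw [← hσ.bind_orbitalMeasure]
    rw [Measure.bind_apply hs measurable_orbitalMeasure.aemeasurable,
      lintegral_map hmeas measurable_height]
    simp only [orbitalMeasure_polarSection]
  exact Measure.ext fun s hs => by rw [apply_eq ν hν s hs, apply_eq ρ hρ s hs, h]

theorem map_inv_orbitalMeasure (a : SU2) : (orbitalMeasure a).map (·⁻¹) = orbitalMeasure a := by
  refine (isBiInvariant_orbitalMeasure a).map_inv.ext (isBiInvariant_orbitalMeasure a) ?_
  rw [Measure.map_map measurable_height measurable_inv]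
  simp only [Function.comp_def, height_inv]

theorem IsBiInvariant.eq_withDensity {ν : Measure SU2} [IsFiniteMeasure ν] (hν : IsBiInvariant ν)
    (hac : ν.map height ≪ haarU.map height) :
    ν = haarU.withDensity ((ν.map height).rnDeriv (haarU.map height) ∘ height) := by
  refine hν.ext (isBiInvariant_haarU.withDensity_comp_height (Measure.measurable_rnDeriv _ _)) ?_
  rw [map_withDensity_comp (measurable_height.measurePreserving _) (Measure.measurable_rnDeriv _ _),
    Measure.withDensity_rnDeriv_eq _ _ hac]

theorem IsBiInvariant.absolutelyContinuous {ν : Measure SU2} [IsFiniteMeasure ν]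
    (hν : IsBiInvariant ν) (hac : ν.map height ≪ haarU.map height) : ν ≪ haarU := by
  rw [hν.eq_withDensity hac]
  exact withDensity_absolutelyContinuous _ _

theorem IsBiInvariant.memLp_density_iff {ν : Measure SU2} [IsFiniteMeasure ν]
    (hν : IsBiInvariant ν) (hac : ν.map height ≪ haarU.map height) {p : ENNReal} :
    MemLp (density ν) p haarU ↔
      MemLp (fun t => ((ν.map height).rnDeriv (haarU.map height) t).toReal) p
        (haarU.map height) := by
  set r := (ν.map height).rnDeriv (haarU.map height)
  have hr_meas : Measurable r := Measure.measurable_rnDeriv _ _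
  have hdensity : density ν =ᵐ[haarU] (fun t => (r t).toReal) ∘ height := by
    have hrn : ν.rnDeriv haarU =ᵐ[haarU] r ∘ height := by
      conv_lhs => rw [hν.eq_withDensity hac]
      exact Measure.rnDeriv_withDensity _ (hr_meas.comp measurable_height)
    filter_upwards [hrn] with u hu
    rw [density, hu, Function.comp_apply, Function.comp_apply]
  rw [memLp_congr_ae hdensity, memLp_map_measure_iff hr_meas.ennreal_toReal.aestronglyMeasurable
    measurable_height.aemeasurable]

end OrbitalMeasure

section CircleKernel

/-- The height on the unit sphere of a point at spherical distance `arccos c` from a point of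
height `z`, in the direction with angle `2 * t`. -/
noncomputable def circleMap (c z t : ℝ) : ℝ :=
  c * z - √(1 - c ^ 2) * √(1 - z ^ 2) * Real.cos (2 * t)

theorem continuous_uncurry_circleMap (c : ℝ) : Continuous (Function.uncurry (circleMap c)) := by
  unfold circleMap Function.uncurry
  fun_prop

theorem continuous_circleMap (c z : ℝ) : Continuous (circleMap c z) := by
  unfold circleMap
  fun_prop

theorem height_polarSection_mul_rot_mul_polarSection (x a : SU2) (t : ℝ) :
    height (polarSection (height x) * rot t * polarSection (height a)) =
      circleMap (height a) (height x) t := by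
  simp only [polarSection, circleMap, height_diagElement_mul_rot_mul_diagElement,
    mul_div_cancel₀ _ (two_ne_zero' ℝ), Real.sin_arccos,
    Real.cos_arccos (height_mem_Icc x).1 (height_mem_Icc x).2,
    Real.cos_arccos (height_mem_Icc a).1 (height_mem_Icc a).2]
  ring

theorem height_polarSection {t : ℝ} (ht : t ∈ Set.Icc (-1 : ℝ) 1) :
    height (polarSection t) = t := by
  rw [polarSection, height_diagElement, mul_div_cancel₀ _ two_ne_zero, Real.cos_arccos ht.1 ht.2]

theorem circleMap_mem_Icc {c z : ℝ} (hc : c ∈ Set.Icc (-1 : ℝ) 1) (hz : z ∈ Set.Icc (-1 : ℝ) 1)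
    (t : ℝ) : circleMap c z t ∈ Set.Icc (-1 : ℝ) 1 := by
  rw [← height_polarSection hc, ← height_polarSection hz,
    ← height_polarSection_mul_rot_mul_polarSection]
  exact height_mem_Icc _

/-- The Markov kernel on heights that moves a point of the unit sphere to a uniformly distributed
point of the circle of spherical radius `arccos c` around it. It describes convolution with the
orbital measure of an element of height `c`. -/
noncomputable def circleKernel (c : ℝ) : Kernel ℝ ℝ where
  toFun z := angleMeasure.map (circleMap c z)
  measurable' := measurable_map_of_uncurry (continuous_uncurry_circleMap c).measurable _

theorem circleKernel_apply (c z : ℝ) : circleKernel c z = angleMeasure.map (circleMap c z) := rfl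

instance (c : ℝ) : IsMarkovKernel (circleKernel c) :=
  ⟨fun z => Measure.isProbabilityMeasure_map (continuous_circleMap c z).aemeasurable⟩

theorem integral_circleKernel {E : Type*} [NormedAddCommGroup E] [NormedSpace ℝ E] (c z : ℝ)
    {f : ℝ → E} (hf : Continuous f) :
    ∫ y, f y ∂circleKernel c z = ∫ t, f (circleMap c z t) ∂angleMeasure :=
  integral_map (continuous_circleMap c z).aemeasurable hf.aestronglyMeasurable

theorem ae_circleKernel_mem_Icc {c z : ℝ} (hc : c ∈ Set.Icc (-1 : ℝ) 1)
    (hz : z ∈ Set.Icc (-1 : ℝ) 1) : ∀ᵐ y ∂circleKernel c z, y ∈ Set.Icc (-1 : ℝ) 1 :=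
  (ae_map_iff (continuous_circleMap c z).aemeasurable measurableSet_Icc).2
    (Filter.Eventually.of_forall (circleMap_mem_Icc hc hz))

theorem map_height_mul_coe_mul (x a : SU2) :
    haarK.map (fun k : SO2 => height (x * k * a)) = circleKernel (height a) (height x) := by
  obtain ⟨k₁, l₁, hx⟩ := exists_eq_mul_polarSection_mul x
  obtain ⟨k₂, l₂, ha⟩ := exists_eq_mul_polarSection_mul a
  have hmp : MeasurePreserving (fun k => l₁ * k * k₂) haarK haarK :=
    (measurePreserving_mul_right haarK k₂).comp (measurePreserving_mul_left haarK l₁)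
  let F : SO2 → ℝ := fun k => height (polarSection (height x) * k * polarSection (height a))
  have hF : Measurable F := measurable_height.comp (by fun_prop)
  have hpolar : (fun k : SO2 => height (x * k * a)) = F ∘ fun k => l₁ * k * k₂ := by
    ext k
    calc height (x * k * a) = height (k₁ * (polarSection (height x) * (l₁ * k * k₂ : SO2)
          * polarSection (height a)) * l₂) := by
          conv_lhs => rw [hx, ha]
          simp only [Subgroup.coe_mul, mul_assoc]
      _ = F (l₁ * k * k₂) := by rw [height_mul_coe, height_coe_mul]
  rw [hpolar, ← Measure.map_map hF hmp.measurable, hmp.map_eq, ← map_rot_angleMeasure,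
    Measure.map_map hF continuous_rot.measurable, circleKernel_apply]
  exact congrArg (angleMeasure.map ·) (funext (height_polarSection_mul_rot_mul_polarSection x a))

theorem measurable_height_mul (x : SU2) : Measurable fun y => height (x * y) :=
  measurable_height.comp (measurable_const_mul x)

theorem map_height_mul_orbitalMeasure (x a : SU2) :
    (orbitalMeasure a).map (fun y => height (x * y)) = circleKernel (height a) (height x) := by
  have hF : Measurable fun k : SO2 => height (x * k * a) := measurable_height.comp (by fun_prop)
  have hcomp : (fun y => height (x * y)) ∘ (fun k : SO2 × SO2 => (k.1 : SU2) * a * (k.2 : SU2)) =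
      (fun k : SO2 => height (x * k * a)) ∘ Prod.fst := by
    ext k
    simp only [Function.comp_apply, ← mul_assoc, height_mul_coe]
  rw [orbitalMeasure, Measure.map_map (measurable_height_mul x) (measurable_orbit a), hcomp,
    ← Measure.map_map hF measurable_fst, (measurePreserving_fst (μ := haarK) (ν := haarK)).map_eq,
    map_height_mul_coe_mul]

theorem lintegral_height_mul_orbitalMeasure {f : ℝ → ENNReal} (hf : Measurable f) (x a : SU2) :
    ∫⁻ y, f (height (x * y)) ∂orbitalMeasure a = ∫⁻ y, f y ∂circleKernel (height a) (height x) := by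
  rw [← map_height_mul_orbitalMeasure, lintegral_map hf (measurable_height_mul x)]

theorem map_height_mconv_orbitalMeasure (ν : Measure SU2) [SFinite ν] (a : SU2) :
    (ν.mconv (orbitalMeasure a)).map height = (ν.map height).bind (circleKernel (height a)) := by
  ext s hs
  have hind : Measurable (s.indicator (1 : ℝ → ENNReal)) := measurable_one.indicator hs
  have hcomp : Measurable fun u : SU2 => s.indicator (1 : ℝ → ENNReal) (height u) :=
    hind.comp measurable_height
  rw [Measure.bind_apply hs (Kernel.aemeasurable _),
    lintegral_map (Kernel.measurable_coe _ hs) measurable_height, ← lintegral_indicator_one hs,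
    lintegral_map hind measurable_height,
    Measure.lintegral_mconv hcomp]
  simp only [lintegral_height_mul_orbitalMeasure hind, lintegral_indicator_one hs]

theorem map_height_convPow_succ (a : SU2) (p : ℕ) :
    (convPow (orbitalMeasure a) (p + 1)).map height =
      ((convPow (orbitalMeasure a) p).map height).bind (circleKernel (height a)) :=
  map_height_mconv_orbitalMeasure _ a

theorem map_height_convPow_two (a : SU2) :
    (convPow (orbitalMeasure a) 2).map height = circleKernel (height a) (height a) := by
  rw [map_height_convPow_succ, convPow_one, map_height_orbitalMeasure,
    Measure.dirac_bind (circleKernel _).measurable]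

theorem setLIntegral_circleKernel_map_height (ν : Measure SU2) (a : SU2) {s r : Set ℝ}
    (hs : MeasurableSet s) (hr : MeasurableSet r) :
    ∫⁻ z in s, circleKernel (height a) z r ∂ν.map height =
      ∫⁻ x, ∫⁻ y, s.indicator 1 (height x) * r.indicator 1 (height (x * y))
        ∂orbitalMeasure a ∂ν := by
  have hr' : Measurable (r.indicator (1 : ℝ → ENNReal)) := measurable_one.indicator hr
  rw [← lintegral_indicator hs,
    lintegral_map ((Kernel.measurable_coe _ hr).indicator hs) measurable_height]
  refine lintegral_congr fun x => ?_
  have hx : Measurable fun y => r.indicator (1 : ℝ → ENNReal) (height (x * y)) :=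
    hr'.comp (measurable_height_mul x)
  rw [lintegral_const_mul _ hx,
    lintegral_height_mul_orbitalMeasure hr', lintegral_indicator_one hr]
  by_cases hx : height x ∈ s <;> simp [hx]

theorem isReversible_circleKernel {c : ℝ} (hc : c ∈ Set.Icc (-1 : ℝ) 1) :
    (circleKernel c).IsReversible (haarU.map height) := by
  intro A B hA hB
  rw [← height_polarSection hc]
  set a := polarSection c
  have hone {s : Set ℝ} (hs : MeasurableSet s) : Measurable (s.indicator (1 : ℝ → ENNReal)) :=
    measurable_one.indicator hs
  have hmeas {F G : SU2 × SU2 → SU2} (hF : Measurable F) (hG : Measurable G) {s r : Set ℝ}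
      (hs : MeasurableSet s) (hr : MeasurableSet r) : Measurable fun q =>
      s.indicator (1 : ℝ → ENNReal) (height (F q)) * r.indicator 1 (height (G q)) :=
    ((hone hs).comp (measurable_height.comp hF)).mul ((hone hr).comp (measurable_height.comp hG))
  -- Detailed balance is the substitution `(x, y) ↦ (x * y, y⁻¹)`.
  calc ∫⁻ z in A, circleKernel (height a) z B ∂haarU.map height
      = ∫⁻ x, ∫⁻ y, A.indicator 1 (height x) * B.indicator 1 (height (x * y))
          ∂orbitalMeasure a ∂haarU :=
        setLIntegral_circleKernel_map_height haarU a hA hB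
    _ = ∫⁻ y, ∫⁻ x, A.indicator 1 (height x) * B.indicator 1 (height (x * y))
          ∂haarU ∂orbitalMeasure a :=
        lintegral_lintegral_swap (hmeas measurable_fst measurable_mul hA hB).aemeasurable
    _ = ∫⁻ y, ∫⁻ x, A.indicator 1 (height (x * y⁻¹)) * B.indicator 1 (height x)
          ∂haarU ∂orbitalMeasure a := by
        refine lintegral_congr fun y => ?_
        rw [← lintegral_mul_right_eq_self
          (fun x => A.indicator 1 (height (x * y⁻¹)) * B.indicator 1 (height x)) y]
        simp only [mul_inv_cancel_right]
    _ = ∫⁻ y, ∫⁻ x, B.indicator 1 (height x) * A.indicator 1 (height (x * y))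
          ∂haarU ∂orbitalMeasure a := by
        conv_rhs => rw [← map_inv_orbitalMeasure]
        rw [lintegral_map (Measurable.lintegral_prod_left'
          (hmeas measurable_fst measurable_mul hB hA)) measurable_inv]
        simp only [mul_comm]
    _ = ∫⁻ x, ∫⁻ y, B.indicator 1 (height x) * A.indicator 1 (height (x * y))
          ∂orbitalMeasure a ∂haarU :=
        (lintegral_lintegral_swap (hmeas measurable_fst measurable_mul hB hA).aemeasurable).symm
    _ = _ := (setLIntegral_circleKernel_map_height haarU a hB hA).symm

end CircleKernel

section LaplaceMean

theorem integrable_angleMeasure {E : Type*} [NormedAddCommGroup E] {f : ℝ → E}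
    (hf : Continuous f) : Integrable f angleMeasure :=
  Integrable.smul_measure ((hf.integrableOn_Icc (a := 0) (b := 2 * Real.pi)).mono_set
    Set.Ioc_subset_Icc_self) ENNReal.ofReal_ne_top

theorem integral_angleMeasure_two_mul {g : ℝ → ℝ} (hg : Continuous g)
    (hper : Function.Periodic g Real.pi) (a : ℝ) :
    ∫ t, g (2 * t) ∂angleMeasure = Real.pi⁻¹ * ∫ x in a..a + Real.pi, g x := by
  have := Real.pi_pos
  have hfour : ∫ x in (0 : ℝ)..4 * Real.pi, g x = 4 * ∫ x in a..a + Real.pi, g x := by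
    have h := hper.intervalIntegral_add_zsmul_eq 4 0 fun _ _ => hg.intervalIntegrable _ _
    rw [hper.intervalIntegral_add_eq a 0]
    simpa only [zero_add, zsmul_eq_mul, Int.cast_ofNat] using h
  rw [integral_angleMeasure, intervalIntegral.integral_comp_mul_left g two_ne_zero, mul_zero,
    ← mul_assoc, show (2 : ℝ) * 2 = 4 by norm_num, hfour]
  simp only [smul_eq_mul]
  field_simp
  ring

/-- The moments of the arcsine law. -/
noncomputable def cosMoment (j : ℕ) : ℝ := ∫ t, Real.cos (2 * t) ^ j ∂angleMeasure

theorem cosMoment_two_mul (k : ℕ) :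
    cosMoment (2 * k) = ∏ i ∈ Finset.range k, (2 * i + 1 : ℝ) / (2 * i + 2) := by
  have hper : Function.Periodic (fun x => Real.cos x ^ (2 * k)) Real.pi := fun x => by
    simp only [Real.cos_add_pi, (even_two_mul k).neg_pow]
  rw [cosMoment, integral_angleMeasure_two_mul (by fun_prop) hper (-(Real.pi / 2))]
  have hshift := intervalIntegral.integral_comp_sub_right (a := 0) (b := Real.pi)
    (fun x => Real.cos x ^ (2 * k)) (Real.pi / 2)
  simp only [Real.cos_sub_pi_div_two, integral_sin_pow_even] at hshift
  rw [show -(Real.pi / 2) + Real.pi = Real.pi - Real.pi / 2 by ring, ← zero_sub (Real.pi / 2),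
    ← hshift, inv_mul_cancel_left₀ Real.pi_ne_zero]

theorem cosMoment_of_odd {j : ℕ} (hj : Odd j) : cosMoment j = 0 := by
  have hper : Function.Periodic (fun t => Real.cos (2 * t) ^ j) (2 * Real.pi) := fun t => by
    have := Real.cos_periodic.nat_mul 2 (2 * t)
    simp only
    rw [← this]
    push_cast
    ring_nf
  have hneg (t : ℝ) : Real.cos (2 * (t + Real.pi / 2)) ^ j = -Real.cos (2 * t) ^ j := by
    rw [mul_add, mul_div_cancel₀ _ two_ne_zero, Real.cos_add_pi, hj.neg_pow]
  refine self_eq_neg.1 ?_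
  calc cosMoment j = ∫ t, Real.cos (2 * (t + Real.pi / 2)) ^ j ∂angleMeasure :=
        (integral_angleMeasure_add hper (Real.pi / 2)).symm
    _ = -cosMoment j := by simp_rw [hneg, integral_neg, cosMoment]

/-- The average of `(a + √b * cos t) ^ k` over all angles `t`, written as a polynomial in `a` and
`b` so that it makes sense in every commutative real algebra. For `b = a ^ 2 - 1` this is Laplace's
formula for the Legendre polynomial of degree `k`. -/
noncomputable def laplaceMean {A : Type*} [CommRing A] [Algebra ℝ A] (k : ℕ) (a b : A) : A :=
  ∑ j ∈ Finset.range (k / 2 + 1),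
    (k.choose (2 * j) * cosMoment (2 * j)) • (a ^ (k - 2 * j) * b ^ j)

theorem map_laplaceMean {A B : Type*} [CommRing A] [Algebra ℝ A] [CommRing B] [Algebra ℝ B]
    (φ : A →ₐ[ℝ] B) (k : ℕ) (a b : A) : φ (laplaceMean k a b) = laplaceMean k (φ a) (φ b) := by
  simp only [laplaceMean, map_sum, map_smul, map_mul, map_pow]

theorem integral_add_mul_cos_pow {𝕜 : Type*} [RCLike 𝕜] (a b : 𝕜) (k : ℕ) :
    ∫ t, (a + b * ((Real.cos (2 * t) : ℝ) : 𝕜)) ^ k ∂angleMeasure = laplaceMean k a (b ^ 2) := by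
  have hterm (j : ℕ) : ∫ t, (b * ((Real.cos (2 * t) : ℝ) : 𝕜)) ^ j * a ^ (k - j) * k.choose j
      ∂angleMeasure = (k.choose j * cosMoment j) • (a ^ (k - j) * b ^ j) := by
    have hpow (t : ℝ) : (b * ((Real.cos (2 * t) : ℝ) : 𝕜)) ^ j * a ^ (k - j) * k.choose j =
        (k.choose j * Real.cos (2 * t) ^ j) • (a ^ (k - j) * b ^ j) := by
      rw [RCLike.real_smul_eq_coe_mul]
      push_cast
      ring
    simp_rw [hpow]
    rw [integral_smul_const, integral_const_mul, cosMoment]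
  simp_rw [add_comm a, add_pow]
  rw [integral_finsetSum _ fun j _ => integrable_angleMeasure (by fun_prop), laplaceMean]
  simp_rw [hterm]
  refine (Finset.sum_of_injOn (2 * ·) (fun i _ j _ h => by simpa using h) (fun j hj => ?_)
    (fun j hj hodd => ?_) fun j _ => by rw [pow_mul]).symm
  · rw [Finset.mem_coe, Finset.mem_range] at hj ⊢
    lia
  · rcases Nat.even_or_odd' j with ⟨i, rfl | rfl⟩
    · rw [Finset.mem_range] at hj
      exact (hodd ⟨i, by rw [Finset.mem_coe, Finset.mem_range]; lia, rfl⟩).elim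
    · rw [cosMoment_of_odd ⟨i, rfl⟩, mul_zero, zero_smul]

end LaplaceMean

section CircleOp

theorem one_sub_sq_nonneg {c : ℝ} (hc : c ∈ Set.Icc (-1 : ℝ) 1) : 0 ≤ 1 - c ^ 2 :=
  sub_nonneg.2 ((sq_le_one_iff_abs_le_one c).2 (abs_le.2 hc))

/-- The action of `circleKernel c` on polynomials: each `X ^ k` is replaced by its average over the
circles. -/
noncomputable def circleOp (c : ℝ) : ℝ[X] →ₗ[ℝ] ℝ[X] :=
  Polynomial.lsum fun k =>
    LinearMap.toSpanSingleton ℝ ℝ[X] (laplaceMean k (C c * X) (C (1 - c ^ 2) * (1 - X ^ 2)))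

theorem circleOp_monomial (c : ℝ) (k : ℕ) (r : ℝ) :
    circleOp c (monomial k r) = r • laplaceMean k (C c * X) (C (1 - c ^ 2) * (1 - X ^ 2)) := by
  rw [circleOp, Polynomial.lsum_apply, sum_monomial_index _ _ (LinearMap.map_zero _),
    LinearMap.toSpanSingleton_apply]

theorem integrable_circleKernel {E : Type*} [NormedAddCommGroup E] {f : ℝ → E} (hf : Continuous f)
    (c z : ℝ) : Integrable f (circleKernel c z) :=
  (integrable_map_measure hf.aestronglyMeasurable (continuous_circleMap c z).aemeasurable).2
    (integrable_angleMeasure (hf.comp (continuous_circleMap c z)))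

theorem integral_pow_circleKernel {c z : ℝ} (hc : c ∈ Set.Icc (-1 : ℝ) 1)
    (hz : z ∈ Set.Icc (-1 : ℝ) 1) (k : ℕ) :
    ∫ y, y ^ k ∂circleKernel c z = laplaceMean k (c * z) ((1 - c ^ 2) * (1 - z ^ 2)) := by
  rw [integral_circleKernel c z (continuous_pow k)]
  have h := integral_add_mul_cos_pow (c * z) (-(√(1 - c ^ 2) * √(1 - z ^ 2))) k
  rw [neg_sq, mul_pow, Real.sq_sqrt (one_sub_sq_nonneg hc), Real.sq_sqrt (one_sub_sq_nonneg hz)]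
    at h
  simpa only [circleMap, sub_eq_add_neg, ← neg_mul, RCLike.ofReal_real_eq_id, id] using h

theorem eval_circleOp {c z : ℝ} (hc : c ∈ Set.Icc (-1 : ℝ) 1) (hz : z ∈ Set.Icc (-1 : ℝ) 1)
    (p : ℝ[X]) : (circleOp c p).eval z = ∫ y, p.eval y ∂circleKernel c z := by
  induction p using Polynomial.induction_on' with
  | add p q hp hq =>
    simp only [map_add, eval_add, hp, hq]
    exact (integral_add (integrable_circleKernel p.continuous c z)
      (integrable_circleKernel q.continuous c z)).symm
  | monomial k r =>
    rw [circleOp_monomial, eval_smul, ← coe_aeval_eq_eval, map_laplaceMean]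
    simp only [eval_monomial, integral_const_mul, integral_pow_circleKernel hc hz, smul_eq_mul,
      map_mul, map_sub, map_pow, map_one, aeval_C, aeval_X, Algebra.algebraMap_self_apply]

/-- The eigenvalue of `circleOp c` on the Legendre polynomial of degree `k`. It is the value at `c`
of that polynomial, normalised to be `1` at `1`. -/
noncomputable def circleEigenvalue (c : ℝ) (k : ℕ) : ℝ := laplaceMean k c (c ^ 2 - 1)

theorem natDegree_one_sub_X_sq_le : (1 - X ^ 2 : ℝ[X]).natDegree ≤ 2 := by compute_degree

theorem natDegree_laplaceMean_le (c : ℝ) (k : ℕ) :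
    (laplaceMean k (C c * X) (C (1 - c ^ 2) * (1 - X ^ 2))).natDegree ≤ k := by
  refine natDegree_sum_le_of_forall_le _ _ fun j hj => ?_
  have hlin : ((C c * X) ^ (k - 2 * j)).natDegree ≤ (k - 2 * j) * 1 :=
    natDegree_pow_le_of_le _ ((natDegree_C_mul_le _ _).trans natDegree_X_le)
  have hquad : ((C (1 - c ^ 2) * (1 - X ^ 2)) ^ j : ℝ[X]).natDegree ≤ j * 2 :=
    natDegree_pow_le_of_le _ ((natDegree_C_mul_le _ _).trans natDegree_one_sub_X_sq_le)
  have := Finset.mem_range.1 hj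
  exact (natDegree_smul_le _ _).trans (natDegree_mul_le.trans (by lia))

theorem coeff_laplaceMean (c : ℝ) (k : ℕ) :
    (laplaceMean k (C c * X) (C (1 - c ^ 2) * (1 - X ^ 2))).coeff k = circleEigenvalue c k := by
  rw [laplaceMean, finsetSum_coeff, circleEigenvalue, laplaceMean]
  refine Finset.sum_congr rfl fun j hj => ?_
  have hjk := Finset.mem_range.1 hj
  have htop : ((1 - X ^ 2 : ℝ[X]) ^ j).coeff (j * 2) = (-1) ^ j := by
    rw [coeff_pow_of_natDegree_le natDegree_one_sub_X_sq_le, coeff_sub, coeff_X_pow_self, coeff_one]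
    norm_num
  rw [coeff_smul, mul_pow, mul_pow, mul_mul_mul_comm, ← C_pow, ← C_pow, ← C_mul, coeff_C_mul,
    coeff_X_pow_mul', if_pos (Nat.sub_le k _), show k - (k - 2 * j) = j * 2 by lia, htop, mul_assoc,
    ← mul_pow, mul_neg_one, neg_sub]

theorem natDegree_circleOp_le (c : ℝ) {n : ℕ} {p : ℝ[X]} (hp : p.natDegree ≤ n) :
    (circleOp c p).natDegree ≤ n := by
  rw [p.as_sum_range' (n + 1) (by lia), map_sum]
  refine natDegree_sum_le_of_forall_le _ _ fun k hk => ?_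
  rw [circleOp_monomial]
  exact (natDegree_smul_le _ _).trans
    ((natDegree_laplaceMean_le c k).trans (Finset.mem_range_succ_iff.1 hk))

theorem coeff_circleOp (c : ℝ) {n : ℕ} {p : ℝ[X]} (hp : p.natDegree ≤ n) :
    (circleOp c p).coeff n = circleEigenvalue c n * p.coeff n := by
  have hlower : ∀ k ∈ Finset.range n, (circleOp c (monomial k (p.coeff k))).coeff n = 0 := by
    intro k hk
    rw [circleOp_monomial, coeff_smul, coeff_eq_zero_of_natDegree_lt
      ((natDegree_laplaceMean_le c k).trans_lt (Finset.mem_range.1 hk)), smul_zero]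
  conv_lhs => rw [p.as_sum_range' (n + 1) (by lia)]
  rw [map_sum, finsetSum_coeff, Finset.sum_range_succ, Finset.sum_eq_zero hlower, zero_add,
    circleOp_monomial, coeff_smul, coeff_laplaceMean, smul_eq_mul, mul_comm]

end CircleOp

section EigenvalueBounds

theorem circleEigenvalue_eq_integral {c : ℝ} (hc : c ∈ Set.Icc (-1 : ℝ) 1) (k : ℕ) :
    (circleEigenvalue c k : ℂ) =
      ∫ t, ((c : ℂ) + √(1 - c ^ 2) * Complex.I * Real.cos (2 * t)) ^ k ∂angleMeasure := by
  have hsq : ((√(1 - c ^ 2) : ℝ) * Complex.I) ^ 2 = Complex.ofRealAm (c ^ 2 - 1) := by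
    rw [mul_pow, Complex.I_sq, ← Complex.ofReal_pow, Real.sq_sqrt (one_sub_sq_nonneg hc),
      Complex.ofRealAm_coe]
    push_cast
    ring
  refine Eq.trans ?_ (integral_add_mul_cos_pow (c : ℂ) (√(1 - c ^ 2) * Complex.I) k).symm
  rw [hsq]
  exact map_laplaceMean Complex.ofRealAm k c (c ^ 2 - 1)

theorem norm_add_I_mul_cos_le {c : ℝ} (hc : c ∈ Set.Icc (-1 : ℝ) 1) (x : ℝ) :
    ‖(c : ℂ) + √(1 - c ^ 2) * Complex.I * Real.cos x‖ ≤
      Real.exp (-((1 - c ^ 2) / 2) * Real.sin x ^ 2) := by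
  have hmk : (c : ℂ) + √(1 - c ^ 2) * Complex.I * Real.cos x = ⟨c, √(1 - c ^ 2) * Real.cos x⟩ := by
    rw [Complex.mk_eq_add_mul_I, Complex.ofReal_mul]
    ring
  have hnorm : ‖(c : ℂ) + √(1 - c ^ 2) * Complex.I * Real.cos x‖ ^ 2 =
      1 - (1 - c ^ 2) * Real.sin x ^ 2 := by
    rw [hmk, ← Complex.normSq_eq_norm_sq, Complex.normSq_mk, Real.sin_sq]
    linear_combination Real.cos x ^ 2 * Real.sq_sqrt (one_sub_sq_nonneg hc)
  refine le_of_sq_le_sq ?_ (Real.exp_pos _).le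
  calc _ = -((1 - c ^ 2) * Real.sin x ^ 2) + 1 := by rw [hnorm]; ring
    _ ≤ Real.exp (-((1 - c ^ 2) * Real.sin x ^ 2)) := Real.add_one_le_exp _
    _ = Real.exp (-((1 - c ^ 2) / 2) * Real.sin x ^ 2) ^ 2 := by
      rw [← Real.exp_nat_mul]
      ring_nf

theorem intervalIntegral_exp_neg_sin_sq_le {A : ℝ} (hA : 0 < A) :
    ∫ x in -(Real.pi / 2)..Real.pi / 2, Real.exp (-A * Real.sin x ^ 2) ≤
      √(Real.pi / (A * (2 / Real.pi) ^ 2)) := by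
  have hpi := Real.pi_pos
  have hgauss : Integrable fun x : ℝ => Real.exp (-(A * (2 / Real.pi) ^ 2) * x ^ 2) :=
    integrable_exp_neg_mul_sq (by positivity)
  have hle : ∀ x ∈ Set.Ioc (-(Real.pi / 2)) (Real.pi / 2), Real.exp (-A * Real.sin x ^ 2) ≤
      Real.exp (-(A * (2 / Real.pi) ^ 2) * x ^ 2) := by
    intro x hx
    have hsin : (2 / Real.pi * |x|) ^ 2 ≤ |Real.sin x| ^ 2 :=
      pow_le_pow_left₀ (by positivity) (Real.mul_abs_le_abs_sin (abs_le.2 ⟨hx.1.le, hx.2⟩)) 2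
    rw [mul_pow, sq_abs, sq_abs] at hsin
    exact Real.exp_le_exp.2 (by nlinarith)
  have hint : IntegrableOn (fun x => Real.exp (-A * Real.sin x ^ 2))
      (Set.Ioc (-(Real.pi / 2)) (Real.pi / 2)) :=
    (Continuous.integrableOn_Icc (by fun_prop)).mono_set Set.Ioc_subset_Icc_self
  rw [← integral_gaussian, intervalIntegral.integral_of_le (by linarith)]
  exact (setIntegral_mono_on hint hgauss.integrableOn measurableSet_Ioc hle).trans
    (setIntegral_le_integral hgauss (Filter.Eventually.of_forall fun x => (Real.exp_pos _).le))

theorem integral_exp_neg_sin_sq_le {A : ℝ} (hA : 0 < A) :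
    ∫ t, Real.exp (-A * Real.sin (2 * t) ^ 2) ∂angleMeasure ≤ 1 / √A := by
  have hpi := Real.pi_pos
  have hper : Function.Periodic (fun x => Real.exp (-A * Real.sin x ^ 2)) Real.pi := fun x => by
    simp only [Real.sin_add_pi, neg_sq]
  have hsq : Real.pi / (A * (2 / Real.pi) ^ 2) ≤ (Real.pi * (1 / √A)) ^ 2 := by
    rw [mul_pow, div_pow 1, Real.sq_sqrt hA.le]
    field_simp
    linarith [Real.pi_le_four]
  rw [integral_angleMeasure_two_mul (by fun_prop) hper (-(Real.pi / 2)), inv_mul_le_iff₀ hpi,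
    show -(Real.pi / 2) + Real.pi = Real.pi / 2 by ring]
  exact (intervalIntegral_exp_neg_sin_sq_le hA).trans (Real.sqrt_le_iff.2 ⟨by positivity, hsq⟩)

theorem abs_circleEigenvalue_le {c : ℝ} (hc : c ^ 2 < 1) {k : ℕ} (hk : 0 < k) :
    |circleEigenvalue c k| ≤ 1 / √(k * ((1 - c ^ 2) / 2)) := by
  have hc' : c ∈ Set.Icc (-1 : ℝ) 1 := abs_le.1 ((sq_le_one_iff_abs_le_one c).1 hc.le)
  have hA : 0 < k * ((1 - c ^ 2) / 2) :=
    mul_pos (Nat.cast_pos.2 hk) (half_pos (sub_pos.2 hc))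
  rw [← Real.norm_eq_abs, ← Complex.norm_real, circleEigenvalue_eq_integral hc']
  refine (norm_integral_le_of_norm_le (integrable_angleMeasure (by fun_prop))
    (Filter.Eventually.of_forall fun t => ?_)).trans (integral_exp_neg_sin_sq_le hA)
  calc ‖((c : ℂ) + √(1 - c ^ 2) * Complex.I * Real.cos (2 * t)) ^ k‖
      ≤ Real.exp (-((1 - c ^ 2) / 2) * Real.sin (2 * t) ^ 2) ^ k := by
        rw [norm_pow]
        exact pow_le_pow_left₀ (norm_nonneg _) (norm_add_I_mul_cos_le hc' _) k
    _ = Real.exp (-(k * ((1 - c ^ 2) / 2)) * Real.sin (2 * t) ^ 2) := by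
        rw [← Real.exp_nat_mul]
        ring_nf

end EigenvalueBounds

section Archimedes

theorem integral_eval_eq_of_integral_pow_eq {a b : ℝ} {μ ν : Measure ℝ} [IsFiniteMeasure μ]
    [IsFiniteMeasure ν] (hμ : ∀ᵐ x ∂μ, x ∈ Set.Icc a b) (hν : ∀ᵐ x ∂ν, x ∈ Set.Icc a b)
    (h : ∀ k : ℕ, ∫ x, x ^ k ∂μ = ∫ x, x ^ k ∂ν) (p : ℝ[X]) :
    ∫ x, p.eval x ∂μ = ∫ x, p.eval x ∂ν := by
  induction p using Polynomial.induction_on' with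
  | add p q hp hq =>
    simp only [eval_add]
    rw [integral_add, integral_add, hp, hq]
    all_goals
      exact integrable_of_continuous_of_ae_mem (Polynomial.continuous _) isCompact_Icc ‹_›
  | monomial k r => simp only [eval_monomial, integral_const_mul, h]

theorem abs_integral_sub_integral_le {α : Type*} [MeasurableSpace α] {μ : Measure α}
    [IsFiniteMeasure μ] {f g : α → ℝ} (hf : Integrable f μ) (hg : Integrable g μ) {ε : ℝ}
    (h : ∀ᵐ x ∂μ, |f x - g x| ≤ ε) : |∫ x, f x ∂μ - ∫ x, g x ∂μ| ≤ ε * μ.real Set.univ := by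
  rw [← integral_sub hf hg]
  exact norm_integral_le_of_norm_le_const (f := fun x => f x - g x) h

theorem ext_of_integral_pow_eq {a b : ℝ} {μ ν : Measure ℝ} [IsFiniteMeasure μ] [IsFiniteMeasure ν]
    (hμ : ∀ᵐ x ∂μ, x ∈ Set.Icc a b) (hν : ∀ᵐ x ∂ν, x ∈ Set.Icc a b)
    (h : ∀ k : ℕ, ∫ x, x ^ k ∂μ = ∫ x, x ^ k ∂ν) : μ = ν := by
  refine ext_of_forall_integral_eq_of_IsFiniteMeasure fun f => eq_of_abs_sub_le_all fun ε hε => ?_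
  set R := μ.real Set.univ + ν.real Set.univ + 1
  have hR : 0 < R := by positivity
  obtain ⟨p, hp⟩ := exists_polynomial_near_of_continuousOn a b f f.continuous.continuousOn
    (ε / R) (div_pos hε hR)
  have hclose (ρ : Measure ℝ) [IsFiniteMeasure ρ] (hρ : ∀ᵐ x ∂ρ, x ∈ Set.Icc a b) :
      |∫ x, p.eval x ∂ρ - ∫ x, f x ∂ρ| ≤ ε / R * ρ.real Set.univ :=
    abs_integral_sub_integral_le
      (integrable_of_continuous_of_ae_mem p.continuous isCompact_Icc hρ)
      (f.integrable ρ) (hρ.mono fun x hx => (hp x hx).le)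
  calc |∫ x, f x ∂μ - ∫ x, f x ∂ν|
      = |(∫ x, p.eval x ∂ν - ∫ x, f x ∂ν) - (∫ x, p.eval x ∂μ - ∫ x, f x ∂μ)| := by
        rw [integral_eval_eq_of_integral_pow_eq hμ hν h p, sub_sub_sub_cancel_left]
    _ ≤ ε / R * ν.real Set.univ + ε / R * μ.real Set.univ :=
        (abs_sub _ _).trans (add_le_add (hclose ν hν) (hclose μ hμ))
    _ ≤ ε / R * R := by
        rw [← mul_add]
        gcongr
        linarith
    _ = ε := div_mul_cancel₀ ε hR.ne'

theorem ae_bind_circleKernel_mem_Icc {c : ℝ} (hc : c ∈ Set.Icc (-1 : ℝ) 1) {μ : Measure ℝ}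
    [SFinite μ] (hμ : ∀ᵐ x ∂μ, x ∈ Set.Icc (-1 : ℝ) 1) :
    ∀ᵐ x ∂μ.bind (circleKernel c), x ∈ Set.Icc (-1 : ℝ) 1 :=
  Measure.ae_comp_of_ae_ae measurableSet_Icc (hμ.mono fun _ hz => ae_circleKernel_mem_Icc hc hz)

theorem integral_eval_bind_circleKernel {c : ℝ} (hc : c ∈ Set.Icc (-1 : ℝ) 1) {μ : Measure ℝ}
    [IsFiniteMeasure μ] (hμ : ∀ᵐ x ∂μ, x ∈ Set.Icc (-1 : ℝ) 1) (p : ℝ[X]) :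
    ∫ x, p.eval x ∂μ.bind (circleKernel c) = ∫ x, (circleOp c p).eval x ∂μ := by
  rw [integral_bind_kernel (integrable_of_continuous_of_ae_mem p.continuous isCompact_Icc
    (ae_bind_circleKernel_mem_Icc hc hμ))]
  exact integral_congr_ae (hμ.mono fun z hz => (eval_circleOp hc hz p).symm)

theorem degree_circleOp_sub_lt (c : ℝ) {n : ℕ} {p : ℝ[X]} (hp : p.natDegree ≤ n) :
    (circleOp c p - circleEigenvalue c n • p).degree < n := by
  refine (degree_lt_iff_coeff_zero _ n).2 fun m hm => ?_
  rcases hm.eq_or_lt with rfl | hm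
  · rw [coeff_sub, coeff_circleOp c hp, coeff_smul, smul_eq_mul, sub_self]
  · exact coeff_eq_zero_of_natDegree_lt (((natDegree_sub_le _ _).trans
      (max_le (natDegree_circleOp_le c hp) ((natDegree_smul_le _ _).trans hp))).trans_lt hm)

theorem ext_of_bind_circleKernel_eq {c : ℝ} (hc : c ∈ Set.Icc (-1 : ℝ) 1)
    (hne : ∀ n, 0 < n → circleEigenvalue c n ≠ 1) {μ ν : Measure ℝ} [IsProbabilityMeasure μ]
    [IsProbabilityMeasure ν] (hμ : ∀ᵐ x ∂μ, x ∈ Set.Icc (-1 : ℝ) 1)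
    (hν : ∀ᵐ x ∂ν, x ∈ Set.Icc (-1 : ℝ) 1) (hμ' : μ.bind (circleKernel c) = μ)
    (hν' : ν.bind (circleKernel c) = ν) : μ = ν := by
  have hint {ρ : Measure ℝ} [IsFiniteMeasure ρ] (hρ : ∀ᵐ x ∂ρ, x ∈ Set.Icc (-1 : ℝ) 1)
      (hρ' : ρ.bind (circleKernel c) = ρ) (p : ℝ[X]) (s : ℝ) :
      ∫ x, (circleOp c p - s • p).eval x ∂ρ = (1 - s) * ∫ x, p.eval x ∂ρ := by
    have hpoly (q : ℝ[X]) : Integrable (fun x => q.eval x) ρ :=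
      integrable_of_continuous_of_ae_mem q.continuous isCompact_Icc hρ
    simp only [eval_sub, eval_smul, smul_eq_mul]
    rw [integral_sub (hpoly _) ((hpoly p).const_mul s), integral_const_mul,
      ← integral_eval_bind_circleKernel hc hρ, hρ', sub_mul, one_mul]
  have heval (n : ℕ) : ∀ p : ℝ[X], p.natDegree ≤ n → ∫ x, p.eval x ∂μ = ∫ x, p.eval x ∂ν := by
    induction n with
    | zero =>
      intro p hp
      rw [eq_C_of_natDegree_le_zero hp]
      simp only [eval_C, integral_const, probReal_univ]
    | succ n ih =>
      intro p hp
      have hlower := ih _ (natDegree_le_iff_coeff_eq_zero.2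
        ((degree_lt_iff_coeff_zero _ (n + 1)).1 (degree_circleOp_sub_lt c hp)))
      rw [hint hμ hμ', hint hν hν'] at hlower
      exact mul_left_cancel₀ (sub_ne_zero.2 (hne (n + 1) n.succ_pos).symm) hlower
  refine ext_of_integral_pow_eq hμ hν fun k => ?_
  simpa only [eval_pow, eval_X] using heval k (X ^ k) (natDegree_X_pow_le k)

theorem laplaceMean_zero_left_two_mul {A : Type*} [CommRing A] [Algebra ℝ A] (k : ℕ) (b : A) :
    laplaceMean (2 * k) 0 b = cosMoment (2 * k) • b ^ k := by
  rw [laplaceMean, Nat.mul_div_cancel_left _ two_pos, Finset.sum_eq_single_of_mem k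
    (Finset.self_mem_range_succ k), Nat.choose_self, Nat.cast_one, one_mul, Nat.sub_self, pow_zero,
    one_mul]
  intro j hj hjk
  have := Finset.mem_range_succ_iff.1 hj
  rw [zero_pow (by lia), zero_mul, smul_zero]

theorem laplaceMean_zero_left_of_odd {A : Type*} [CommRing A] [Algebra ℝ A] {k : ℕ} (hk : Odd k)
    (b : A) : laplaceMean k 0 b = 0 := by
  refine Finset.sum_eq_zero fun j hj => ?_
  have := Finset.mem_range_succ_iff.1 hj
  obtain ⟨i, rfl⟩ := hk
  rw [zero_pow (by lia), zero_mul, smul_zero]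

theorem circleEigenvalue_zero_ne_one {n : ℕ} (hn : 0 < n) : circleEigenvalue 0 n ≠ 1 := by
  rcases Nat.even_or_odd' n with ⟨k, rfl | rfl⟩
  · obtain ⟨k, rfl⟩ := Nat.exists_eq_succ_of_ne_zero (show k ≠ 0 by lia)
    have hpos : 0 ≤ cosMoment (2 * k.succ) := by
      rw [cosMoment_two_mul]
      positivity
    have hlt : cosMoment (2 * k.succ) < 1 := by
      rw [cosMoment_two_mul, Finset.prod_range_succ]
      refine mul_lt_one_of_nonneg_of_lt_one_right (Finset.prod_le_one (fun i _ => by positivity)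
        fun i _ => (div_le_one (by positivity)).2 (by linarith)) (by positivity)
        ((div_lt_one (by positivity)).2 (by linarith))
    rw [circleEigenvalue, laplaceMean_zero_left_two_mul, zero_pow two_ne_zero, zero_sub]
    rcases neg_one_pow_eq_or ℝ k.succ with h | h <;> rw [h, smul_eq_mul] <;> linarith
  · rw [circleEigenvalue, laplaceMean_zero_left_of_odd ⟨k, rfl⟩]
    exact zero_ne_one

/-- The uniform probability measure on the interval `[-1, 1]`. -/
noncomputable def uniformMeasure : Measure ℝ :=
  ENNReal.ofReal 2⁻¹ • volume.restrict (Set.Ioc (-1) 1)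

instance : IsProbabilityMeasure uniformMeasure := ⟨by
  rw [uniformMeasure, Measure.smul_apply, Measure.restrict_apply_univ, Real.volume_Ioc,
    smul_eq_mul, ← ENNReal.ofReal_mul (by positivity)]
  norm_num⟩

theorem integral_uniformMeasure (f : ℝ → ℝ) :
    ∫ t, f t ∂uniformMeasure = 2⁻¹ * ∫ t in (-1 : ℝ)..1, f t := by
  rw [uniformMeasure, integral_smul_measure, intervalIntegral.integral_of_le (by norm_num),
    ENNReal.toReal_ofReal (by positivity), smul_eq_mul]

theorem ae_uniformMeasure_mem_Icc : ∀ᵐ x ∂uniformMeasure, x ∈ Set.Icc (-1 : ℝ) 1 :=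
  Measure.ae_smul_measure ((ae_restrict_mem measurableSet_Ioc).mono fun _ hx =>
    Set.Ioc_subset_Icc_self hx) _

theorem integral_one_sub_sq_pow_uniformMeasure (k : ℕ) :
    ∫ x, (1 - x ^ 2) ^ k ∂uniformMeasure =
      ∏ i ∈ Finset.range k, (2 * i + 2 : ℝ) / (2 * i + 3) := by
  have hsubst := integral_sin_pow_odd_mul_cos_pow (a := 0) (b := Real.pi) k 0
  simp only [pow_zero, one_mul, mul_one, Real.cos_zero, Real.cos_pi, integral_sin_pow_odd]
    at hsubst
  rw [integral_uniformMeasure, ← hsubst, inv_mul_cancel_left₀ two_ne_zero]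

theorem prod_range_div_mul_prod_range_div (k : ℕ) :
    (∏ i ∈ Finset.range k, (2 * i + 1 : ℝ) / (2 * i + 2)) *
      ∏ i ∈ Finset.range k, (2 * i + 2 : ℝ) / (2 * i + 3) = 1 / (2 * k + 1) := by
  induction k with
  | zero => norm_num
  | succ k ih =>
    rw [Finset.prod_range_succ, Finset.prod_range_succ, mul_mul_mul_comm, ih]
    push_cast
    field_simp
    ring

theorem integral_pow_bind_circleKernel_zero (k : ℕ) :
    ∫ x, x ^ k ∂uniformMeasure.bind (circleKernel 0) = ∫ x, x ^ k ∂uniformMeasure := by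
  have hzero : (0 : ℝ) ∈ Set.Icc (-1 : ℝ) 1 := by simp
  have hop := integral_eval_bind_circleKernel hzero ae_uniformMeasure_mem_Icc (monomial k 1)
  simp only [eval_monomial, one_mul, circleOp_monomial, one_smul, map_zero, zero_mul] at hop
  rw [hop, integral_uniformMeasure (· ^ k), integral_pow]
  rcases Nat.even_or_odd' k with ⟨k, rfl | rfl⟩
  · rw [laplaceMean_zero_left_two_mul]
    simp only [eval_smul, eval_pow, eval_mul, eval_C, eval_sub, eval_one, eval_X, smul_eq_mul,
      zero_pow two_ne_zero, sub_zero, one_mul, integral_const_mul]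
    rw [integral_one_sub_sq_pow_uniformMeasure, cosMoment_two_mul,
      prod_range_div_mul_prod_range_div, one_pow, (odd_two_mul_add_one k).neg_one_pow]
    push_cast
    field_simp
    norm_num
  · rw [laplaceMean_zero_left_of_odd ⟨k, rfl⟩, one_pow, Even.neg_one_pow (by grind)]
    simp only [eval_zero, integral_zero, sub_self, zero_div, mul_zero]

theorem bind_circleKernel_zero_uniformMeasure :
    uniformMeasure.bind (circleKernel 0) = uniformMeasure :=
  ext_of_integral_pow_eq (ae_bind_circleKernel_mem_Icc (by simp) ae_uniformMeasure_mem_Icc)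
    ae_uniformMeasure_mem_Icc integral_pow_bind_circleKernel_zero

instance (ν : Measure SU2) [IsProbabilityMeasure ν] : IsProbabilityMeasure (ν.map height) :=
  Measure.isProbabilityMeasure_map measurable_height.aemeasurable

theorem ae_map_height_mem_Icc (ν : Measure SU2) : ∀ᵐ x ∂ν.map height, x ∈ Set.Icc (-1 : ℝ) 1 :=
  (ae_map_iff measurable_height.aemeasurable measurableSet_Icc).2
    (Filter.Eventually.of_forall height_mem_Icc)

-- Archimedes' theorem: averaging over great circles has only one invariant probability measure.
theorem map_height_haarU : haarU.map height = uniformMeasure :=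
  ext_of_bind_circleKernel_eq (c := 0) (by simp) (fun _ => circleEigenvalue_zero_ne_one)
    (ae_map_height_mem_Icc _) ae_uniformMeasure_mem_Icc
    (isReversible_circleKernel (by simp)).invariant bind_circleKernel_zero_uniformMeasure

end Archimedes

section Legendre

theorem integrable_uniformMeasure {f : ℝ → ℝ} (hf : Continuous f) : Integrable f uniformMeasure :=
  integrable_of_continuous_of_ae_mem hf isCompact_Icc ae_uniformMeasure_mem_Icc

theorem uniformMeasure_absolutelyContinuous : uniformMeasure ≪ volume :=
  Measure.smul_absolutelyContinuous.trans Measure.restrict_le_self.absolutelyContinuous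

/-- The inner product of polynomials in `L²` of the uniform measure on `[-1, 1]`. -/
noncomputable def polyForm : LinearMap.BilinForm ℝ ℝ[X] :=
  LinearMap.mk₂ ℝ (fun p q => ∫ x, (p * q).eval x ∂uniformMeasure)
    (fun p p' q => by
      simp only [add_mul, eval_add]
      exact integral_add (integrable_uniformMeasure (Polynomial.continuous _))
        (integrable_uniformMeasure (Polynomial.continuous _)))
    (fun r p q => by simp only [smul_mul_assoc, eval_smul, integral_smul])
    (fun p q q' => by
      simp only [mul_add, eval_add]
      exact integral_add (integrable_uniformMeasure (Polynomial.continuous _))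
        (integrable_uniformMeasure (Polynomial.continuous _)))
    (fun r p q => by simp only [mul_smul_comm, eval_smul, integral_smul])

theorem polyForm_apply (p q : ℝ[X]) :
    polyForm p q = ∫ x, p.eval x * q.eval x ∂uniformMeasure := by
  simp only [polyForm, LinearMap.mk₂_apply, eval_mul]

theorem polyForm_comm (p q : ℝ[X]) : polyForm p q = polyForm q p := by
  simp only [polyForm_apply, mul_comm]

theorem polyForm_self_pos {p : ℝ[X]} (hp : p ≠ 0) : 0 < polyForm p p := by
  rw [polyForm_apply]
  have hnonneg : 0 ≤ fun x => p.eval x * p.eval x := fun x => mul_self_nonneg _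
  refine (integral_nonneg hnonneg).lt_of_ne' fun hzero => ?_
  rw [integral_eq_zero_iff_of_nonneg hnonneg
    (integrable_uniformMeasure (p.continuous.mul p.continuous))] at hzero
  have hroots : ∀ᵐ x ∂uniformMeasure, x ∉ (p.roots.toFinset : Set ℝ) :=
    uniformMeasure_absolutelyContinuous.ae_le
      (compl_mem_ae_iff.2 (p.roots.toFinset.finite_toSet.measure_zero volume))
  obtain ⟨x, hx, hx'⟩ := (hzero.and hroots).exists
  exact hx' (Multiset.mem_toFinset.2 ((mem_roots hp).2 (mul_self_eq_zero.1 hx)))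

theorem exists_monic_orthogonal {K : Type*} [Field K] (B : LinearMap.BilinForm K K[X])
    (hB : ∀ p, p ≠ 0 → B p p ≠ 0) (n : ℕ) :
    ∃ q : K[X], q.Monic ∧ q.natDegree = n ∧ ∀ r : K[X], r.degree < n → B q r = 0 := by
  let W := degreeLT K n
  have : Module.Finite K W := Module.Finite.equiv (degreeLTEquiv K n).symm
  let restrict : W →ₗ[K] Module.Dual K W := B.domRestrict₁₂ W W
  have hinj : Function.Injective restrict := by
    refine (injective_iff_map_eq_zero restrict).2 fun r hr => ?_
    by_contra hne
    exact hB r (by simpa using hne) (LinearMap.congr_fun hr r)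
  have hsurj := (LinearMap.injective_iff_surjective_of_finrank_eq_finrank
    (Subspace.dual_finrank_eq (K := K) (V := W)).symm).1 hinj
  obtain ⟨r, hr⟩ := hsurj ((B (X ^ n)).domRestrict W)
  have hdeg : (r : K[X]).degree < (X ^ n : K[X]).degree := by
    rw [degree_X_pow]
    exact mem_degreeLT.1 r.2
  refine ⟨X ^ n - (r : K[X]), (monic_X_pow n).sub_of_left hdeg, ?_, fun s hs => ?_⟩
  · rw [natDegree_eq_of_degree_eq (degree_sub_eq_left_of_degree_lt hdeg), natDegree_X_pow]
  · rw [map_sub, LinearMap.sub_apply, sub_eq_zero]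
    exact (LinearMap.congr_fun hr ⟨s, mem_degreeLT.2 hs⟩).symm

/-- The monic Legendre polynomial of degree `n`. -/
noncomputable def monicLegendre (n : ℕ) : ℝ[X] :=
  (exists_monic_orthogonal polyForm (fun _ hp => (polyForm_self_pos hp).ne') n).choose

theorem monic_monicLegendre (n : ℕ) : (monicLegendre n).Monic :=
  (exists_monic_orthogonal polyForm (fun _ hp => (polyForm_self_pos hp).ne') n).choose_spec.1

theorem natDegree_monicLegendre (n : ℕ) : (monicLegendre n).natDegree = n :=
  (exists_monic_orthogonal polyForm (fun _ hp => (polyForm_self_pos hp).ne') n).choose_spec.2.1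

theorem polyForm_monicLegendre {n : ℕ} {r : ℝ[X]} (hr : r.degree < n) :
    polyForm (monicLegendre n) r = 0 :=
  (exists_monic_orthogonal polyForm (fun _ hp => (polyForm_self_pos hp).ne') n).choose_spec.2.2 r hr

theorem polyForm_monicLegendre_pos (n : ℕ) : 0 < polyForm (monicLegendre n) (monicLegendre n) :=
  polyForm_self_pos (monic_monicLegendre n).ne_zero

theorem degree_circleOp_le (c : ℝ) (p : ℝ[X]) : (circleOp c p).degree ≤ p.degree := by
  rcases eq_or_ne p 0 with rfl | hp
  · rw [map_zero]
  · rw [degree_eq_natDegree hp]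
    exact degree_le_of_natDegree_le (natDegree_circleOp_le c le_rfl)

theorem polyForm_circleOp_comm {c : ℝ} (hc : c ∈ Set.Icc (-1 : ℝ) 1) (p q : ℝ[X]) :
    polyForm (circleOp c p) q = polyForm p (circleOp c q) := by
  have hrev := map_height_haarU ▸ isReversible_circleKernel hc
  have hint : Integrable (fun x : ℝ × ℝ => p.eval x.1 * q.eval x.2)
      (uniformMeasure ⊗ₘ circleKernel c) := by
    refine integrable_of_continuous_of_ae_mem (K := Set.Icc (-1) 1 ×ˢ Set.Icc (-1) 1)
      (by fun_prop) (isCompact_Icc.prod isCompact_Icc)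
      ((Measure.ae_compProd_iff (measurableSet_Icc.prod measurableSet_Icc)).2 ?_)
    filter_upwards [ae_uniformMeasure_mem_Icc] with z hz
    exact (ae_circleKernel_mem_Icc hc hz).mono fun y hy => ⟨hz, hy⟩
  have heval (r : ℝ[X]) : ∀ᵐ z ∂uniformMeasure,
      ∫ y, r.eval y ∂circleKernel c z = (circleOp c r).eval z :=
    ae_uniformMeasure_mem_Icc.mono fun z hz => (eval_circleOp hc hz r).symm
  calc polyForm (circleOp c p) q
      = ∫ z, (∫ y, p.eval y ∂circleKernel c z) * q.eval z ∂uniformMeasure := by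
        rw [polyForm_apply]
        exact integral_congr_ae ((heval p).mono fun z hz => by simp only [hz])
    _ = ∫ z, p.eval z * ∫ y, q.eval y ∂circleKernel c z ∂uniformMeasure :=
        (integral_mul_integral_comm_of_isReversible hrev hint).symm
    _ = polyForm p (circleOp c q) := by
        rw [polyForm_apply]
        exact integral_congr_ae ((heval q).mono fun z hz => by simp only [hz])

-- The error term has degree less than `n`, so by symmetry it is orthogonal to itself.
theorem circleOp_monicLegendre {c : ℝ} (hc : c ∈ Set.Icc (-1 : ℝ) 1) (n : ℕ) :
    circleOp c (monicLegendre n) = circleEigenvalue c n • monicLegendre n := by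
  have horth (s : ℝ[X]) (hs : s.degree < n) :
      polyForm (circleOp c (monicLegendre n) - circleEigenvalue c n • monicLegendre n) s = 0 := by
    rw [map_sub, map_smul, LinearMap.sub_apply, LinearMap.smul_apply, polyForm_circleOp_comm hc,
      polyForm_monicLegendre ((degree_circleOp_le c s).trans_lt hs), polyForm_monicLegendre hs,
      smul_zero, sub_zero]
  by_contra hne
  exact (polyForm_self_pos (sub_ne_zero.2 hne)).ne'
    (horth _ (degree_circleOp_sub_lt c (natDegree_monicLegendre n).le))

theorem degree_X_mul_derivative_sub_lt {R : Type*} [CommRing R] {n : ℕ} {q : R[X]}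
    (hq : q.natDegree ≤ n) : (X * derivative q - (n : R) • q).degree < (n : WithBot ℕ) := by
  refine (degree_lt_iff_coeff_zero _ n).2 fun m hm => ?_
  have hcoeff : (X * derivative q - (n : R) • q).coeff m = (m - n) * q.coeff m := by
    rcases m with _ | m
    · simp only [coeff_sub, coeff_X_mul_zero, coeff_smul, smul_eq_mul, Nat.cast_zero]
      ring
    · rw [coeff_sub, coeff_X_mul, coeff_derivative, coeff_smul, smul_eq_mul, Nat.cast_succ]
      ring
  rw [hcoeff]
  rcases hm.eq_or_lt with rfl | hm
  · rw [sub_self, zero_mul]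
  · rw [coeff_eq_zero_of_natDegree_lt (hq.trans_lt hm), mul_zero]

theorem polyForm_monicLegendre_X_mul_derivative (n : ℕ) :
    polyForm (monicLegendre n) (X * derivative (monicLegendre n)) =
      n * polyForm (monicLegendre n) (monicLegendre n) := by
  have h := polyForm_monicLegendre (degree_X_mul_derivative_sub_lt (natDegree_monicLegendre n).le)
  rwa [map_sub, map_smul, smul_eq_mul, sub_eq_zero] at h

theorem eval_one_sq_add_eval_neg_one_sq (q : ℝ[X]) :
    q.eval 1 ^ 2 + q.eval (-1) ^ 2 =
      2 * (polyForm q q + 2 * polyForm q (X * derivative q)) := by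
  have hboundary : ∫ x in (-1 : ℝ)..1, (derivative (X * q ^ 2)).eval x =
      q.eval 1 ^ 2 + q.eval (-1) ^ 2 := by
    rw [intervalIntegral.integral_eq_sub_of_hasDerivAt
      (fun x _ => (X * q ^ 2).hasDerivAt x) ((derivative _).continuous.intervalIntegrable _ _)]
    simp only [eval_mul, eval_pow, eval_X]
    ring
  rw [← hboundary, ← inv_mul_eq_iff_eq_mul₀ two_ne_zero, ← integral_uniformMeasure, polyForm_apply,
    polyForm_apply, ← integral_const_mul, ← integral_add
      (integrable_uniformMeasure (by fun_prop)) (integrable_uniformMeasure (by fun_prop))]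
  congr 1 with x
  simp only [derivative_mul, derivative_X, derivative_sq, eval_add, eval_mul, eval_pow, eval_X,
    eval_C, eval_one]
  ring

theorem eval_one_sq_monicLegendre_le (n : ℕ) :
    (monicLegendre n).eval 1 ^ 2 ≤ (4 * n + 2) * polyForm (monicLegendre n) (monicLegendre n) := by
  have h := eval_one_sq_add_eval_neg_one_sq (monicLegendre n)
  rw [polyForm_monicLegendre_X_mul_derivative] at h
  linarith [sq_nonneg ((monicLegendre n).eval (-1))]

/-- The Legendre polynomial of degree `n`, normalised in `L²` of the uniform probability measure on
`[-1, 1]`. -/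
noncomputable def legendre (n : ℕ) : ℝ[X] :=
  (√(polyForm (monicLegendre n) (monicLegendre n)))⁻¹ • monicLegendre n

theorem degree_legendre (n : ℕ) : (legendre n).degree = n := by
  have hne := (Real.sqrt_pos.2 (polyForm_monicLegendre_pos n)).ne'
  rw [legendre, degree_smul_of_smul_regular _ (IsSMulRegular.of_ne_zero (inv_ne_zero hne)),
    degree_eq_natDegree (monic_monicLegendre n).ne_zero, natDegree_monicLegendre]

/-- The Legendre polynomials, as a sequence containing one polynomial of each degree. -/
noncomputable def legendreSequence : Polynomial.Sequence ℝ := ⟨legendre, degree_legendre⟩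

theorem span_range_legendre : Submodule.span ℝ (Set.range legendre) = ⊤ :=
  legendreSequence.span fun n => (leadingCoeff_ne_zero.2 (legendreSequence.ne_zero n)).isUnit

theorem polyForm_legendre_self (n : ℕ) : polyForm (legendre n) (legendre n) = 1 := by
  have h := polyForm_monicLegendre_pos n
  simp only [legendre, map_smul, LinearMap.smul_apply, smul_eq_mul]
  rw [← mul_assoc, ← mul_inv, Real.mul_self_sqrt h.le, inv_mul_cancel₀ h.ne']

theorem polyForm_legendre_of_lt {m n : ℕ} (h : m < n) :
    polyForm (legendre n) (legendre m) = 0 := by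
  have hdeg : (legendre m).degree < n := (degree_legendre m).trans_lt (Nat.cast_lt.2 h)
  rw [legendre, map_smul, LinearMap.smul_apply, polyForm_monicLegendre hdeg, smul_zero]

theorem polyForm_legendre (m n : ℕ) :
    polyForm (legendre m) (legendre n) = if m = n then 1 else 0 := by
  rcases lt_trichotomy m n with h | rfl | h
  · rw [if_neg h.ne, polyForm_comm, polyForm_legendre_of_lt h]
  · rw [if_pos rfl, polyForm_legendre_self]
  · rw [if_neg h.ne', polyForm_legendre_of_lt h]

theorem eval_one_sq_legendre_le (n : ℕ) : (legendre n).eval 1 ^ 2 ≤ 4 * n + 2 := by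
  have h := polyForm_monicLegendre_pos n
  rw [legendre, eval_smul, smul_eq_mul, mul_pow, inv_pow, Real.sq_sqrt h.le, inv_mul_le_iff₀ h,
    mul_comm]
  exact eval_one_sq_monicLegendre_le n

theorem circleOp_legendre {c : ℝ} (hc : c ∈ Set.Icc (-1 : ℝ) 1) (n : ℕ) :
    circleOp c (legendre n) = circleEigenvalue c n • legendre n := by
  rw [legendre, map_smul, circleOp_monicLegendre hc, smul_comm]

end Legendre

section LegendreExpansion

theorem memLp_eval_uniformMeasure (p : ℝ[X]) : MemLp (fun x => p.eval x) 2 uniformMeasure :=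
  (memLp_two_iff_integrable_sq p.continuous.aestronglyMeasurable).2
    (integrable_uniformMeasure (p.continuous.pow 2))

/-- The class of a polynomial in `L²` of the uniform measure on `[-1, 1]`. -/
noncomputable def polyLp (p : ℝ[X]) : Lp ℝ 2 uniformMeasure := (memLp_eval_uniformMeasure p).toLp _

theorem inner_polyLp (p : ℝ[X]) (f : Lp ℝ 2 uniformMeasure) :
    inner ℝ (polyLp p) f = ∫ x, p.eval x * f x ∂uniformMeasure := by
  rw [L2.inner_def]
  refine integral_congr_ae ((memLp_eval_uniformMeasure p).coeFn_toLp.mono fun x hx => ?_)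
  simp only [polyLp, hx, RCLike.inner_apply, conj_trivial, mul_comm]

theorem inner_polyLp_polyLp (p q : ℝ[X]) : inner ℝ (polyLp p) (polyLp q) = polyForm p q := by
  rw [inner_polyLp, polyForm_apply]
  refine integral_congr_ae ((memLp_eval_uniformMeasure q).coeFn_toLp.mono fun x hx => ?_)
  simp only [polyLp, hx]

theorem orthonormal_legendre : Orthonormal ℝ fun n => polyLp (legendre n) := by
  simp only [orthonormal_iff_ite, inner_polyLp_polyLp, polyForm_legendre, implies_true]

theorem exists_inner_eq_of_summable_norm_sq {ι 𝕜 E : Type*} [RCLike 𝕜] [NormedAddCommGroup E]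
    [InnerProductSpace 𝕜 E] [CompleteSpace E] {v : ι → E} (hv : Orthonormal 𝕜 v) {a : ι → 𝕜}
    (ha : Summable fun i => ‖a i‖ ^ 2) : ∃ f : E, ∀ i, inner 𝕜 (v i) f = a i := by
  classical
  have hsum : Summable fun i => a i • v i := by
    simpa only [LinearIsometry.toSpanSingleton_apply] using
      (hv.orthogonalFamily.summable_iff_norm_sq_summable a).2 ha
  refine ⟨∑' i, a i • v i, fun i => ?_⟩
  rw [← innerSL_apply_apply (𝕜 := 𝕜), (innerSL 𝕜 (v i)).map_tsum hsum,
    tsum_eq_single i fun j hj => ?_]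
  · simp only [innerSL_apply_apply, inner_smul_right, orthonormal_iff_ite.1 hv, if_pos, mul_one]
  · rw [innerSL_apply_apply, inner_smul_right, hv.inner_eq_zero hj.symm, mul_zero]

end LegendreExpansion

section DensityOfMoments

theorem integral_withDensity_ofReal_sub {α : Type*} [MeasurableSpace α] {μ : Measure α}
    {f g : α → ℝ} (hf : AEMeasurable f μ)
    (hpos : Integrable g (μ.withDensity fun x => ENNReal.ofReal (f x)))
    (hneg : Integrable g (μ.withDensity fun x => ENNReal.ofReal (-f x))) :
    ∫ x, g x ∂μ.withDensity (fun x => ENNReal.ofReal (f x)) -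
      ∫ x, g x ∂μ.withDensity (fun x => ENNReal.ofReal (-f x)) = ∫ x, g x * f x ∂μ := by
  have hf' : AEMeasurable (fun x => -f x) μ := hf.neg
  have hlt (h : α → ℝ) : ∀ᵐ x ∂μ, ENNReal.ofReal (h x) < ⊤ :=
    Filter.Eventually.of_forall fun _ => ENNReal.ofReal_lt_top
  rw [integrable_withDensity_iff_integrable_smul₀' hf.ennreal_ofReal (hlt _)] at hpos
  rw [integrable_withDensity_iff_integrable_smul₀' hf'.ennreal_ofReal (hlt _)] at hneg
  rw [integral_withDensity_eq_integral_toReal_smul₀ hf.ennreal_ofReal (hlt _),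
    integral_withDensity_eq_integral_toReal_smul₀ hf'.ennreal_ofReal (hlt _),
    ← integral_sub hpos hneg]
  simp only [ENNReal.toReal_ofReal', smul_eq_mul, ← sub_mul, max_zero_sub_eq_self]
  simp only [mul_comm]

theorem le_withDensity_of_integral_pow_mul_eq {a b : ℝ} {μ ν : Measure ℝ} [IsFiniteMeasure ν]
    (hμ : ∀ᵐ x ∂μ, x ∈ Set.Icc a b) (hν : ∀ᵐ x ∂ν, x ∈ Set.Icc a b) {f : ℝ → ℝ}
    (hf : Integrable f μ) (h : ∀ k : ℕ, ∫ x, x ^ k * f x ∂μ = ∫ x, x ^ k ∂ν) :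
    ν ≤ μ.withDensity fun x => ENNReal.ofReal (f x) := by
  set pos := μ.withDensity fun x => ENNReal.ofReal (f x)
  set neg := μ.withDensity fun x => ENNReal.ofReal (-f x)
  have : IsFiniteMeasure pos := isFiniteMeasure_withDensity_ofReal hf.2
  have : IsFiniteMeasure neg := isFiniteMeasure_withDensity_ofReal hf.neg.2
  have hpos : ∀ᵐ x ∂pos, x ∈ Set.Icc a b := (withDensity_absolutelyContinuous _ _).ae_le hμ
  have hneg : ∀ᵐ x ∂neg, x ∈ Set.Icc a b := (withDensity_absolutelyContinuous _ _).ae_le hμ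
  have hint {ρ : Measure ℝ} [IsFiniteMeasure ρ] (hρ : ∀ᵐ x ∂ρ, x ∈ Set.Icc a b) (k : ℕ) :
      Integrable (fun x => x ^ k) ρ :=
    integrable_of_continuous_of_ae_mem (continuous_pow k) isCompact_Icc hρ
  have hsum : ν + neg = pos := by
    refine ext_of_integral_pow_eq (ae_add_measure_iff.2 ⟨hν, hneg⟩) hpos fun k => ?_
    rw [integral_add_measure (hint hν k) (hint hneg k), ← h, ← eq_sub_iff_add_eq]
    exact (integral_withDensity_ofReal_sub hf.aemeasurable (hint hpos k) (hint hneg k)).symm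
  exact hsum ▸ Measure.le_add_right le_rfl

theorem memLp_toReal_rnDeriv_of_le_withDensity {α : Type*} [MeasurableSpace α] {μ ν : Measure α}
    [SigmaFinite μ] [IsFiniteMeasure ν] {p : ENNReal} {f : α → ℝ} (hf : MemLp f p μ)
    (h : ν ≤ μ.withDensity fun x => ENNReal.ofReal (f x)) :
    MemLp (fun x => (ν.rnDeriv μ x).toReal) p μ := by
  have hac : ν ≪ μ := h.absolutelyContinuous.trans (withDensity_absolutelyContinuous _ _)
  have hle : ν.rnDeriv μ ≤ᵐ[μ] fun x => ENNReal.ofReal (f x) := by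
    refine ae_le_of_forall_setLIntegral_le_of_sigmaFinite (Measure.measurable_rnDeriv _ _)
      fun s hs _ => ?_
    rw [Measure.setLIntegral_rnDeriv hac, ← withDensity_apply _ hs]
    exact h s
  refine hf.mono (Measure.measurable_rnDeriv _ _).ennreal_toReal.aestronglyMeasurable
    (hle.mono fun x hx => ?_)
  rw [Real.norm_of_nonneg ENNReal.toReal_nonneg]
  exact ENNReal.toReal_le_of_le_ofReal (norm_nonneg _)
    (hx.trans (ENNReal.ofReal_le_ofReal (le_abs_self _)))

theorem exists_lp_integral_mul_eq_of_summable {ν : Measure ℝ} [IsFiniteMeasure ν]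
    (hν : ∀ᵐ x ∂ν, x ∈ Set.Icc (-1 : ℝ) 1)
    (hs : Summable fun n => (∫ x, (legendre n).eval x ∂ν) ^ 2) :
    ∃ f : Lp ℝ 2 uniformMeasure,
      ∀ p : ℝ[X], ∫ x, p.eval x * f x ∂uniformMeasure = ∫ x, p.eval x ∂ν := by
  obtain ⟨f, hf⟩ := exists_inner_eq_of_summable_norm_sq orthonormal_legendre
    (by simpa only [Real.norm_eq_abs, sq_abs] using hs)
  refine ⟨f, fun p => ?_⟩
  have hνint (q : ℝ[X]) : Integrable (fun x => q.eval x) ν :=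
    integrable_of_continuous_of_ae_mem q.continuous isCompact_Icc hν
  have hfint (q : ℝ[X]) : Integrable (fun x => q.eval x * f x) uniformMeasure :=
    (memLp_eval_uniformMeasure q).integrable_mul (Lp.memLp f)
  have hp : p ∈ Submodule.span ℝ (Set.range legendre) :=
    span_range_legendre ▸ Submodule.mem_top
  induction hp using Submodule.span_induction with
  | mem q hq => obtain ⟨n, rfl⟩ := hq; rw [← inner_polyLp, hf]
  | zero => simp only [eval_zero, zero_mul, integral_zero]
  | add q r _ _ hq hr =>
    simp only [eval_add, add_mul]
    rw [integral_add (hfint q) (hfint r), integral_add (hνint q) (hνint r), hq, hr]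
  | smul c q _ hq =>
    simp only [eval_smul, smul_eq_mul, mul_assoc, integral_const_mul, hq]

theorem memLp_rnDeriv_uniformMeasure_of_summable {ν : Measure ℝ} [IsFiniteMeasure ν]
    (hν : ∀ᵐ x ∂ν, x ∈ Set.Icc (-1 : ℝ) 1)
    (hs : Summable fun n => (∫ x, (legendre n).eval x ∂ν) ^ 2) :
    ν ≪ uniformMeasure ∧ MemLp (fun x => (ν.rnDeriv uniformMeasure x).toReal) 2 uniformMeasure := by
  obtain ⟨f, hf⟩ := exists_lp_integral_mul_eq_of_summable hν hs
  have hle : ν ≤ uniformMeasure.withDensity fun x => ENNReal.ofReal (f x) :=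
    le_withDensity_of_integral_pow_mul_eq ae_uniformMeasure_mem_Icc hν
      ((Lp.memLp f).integrable one_le_two) fun k => by
        simpa only [eval_pow, eval_X] using hf (X ^ k)
  exact ⟨hle.absolutelyContinuous.trans (withDensity_absolutelyContinuous _ _),
    memLp_toReal_rnDeriv_of_le_withDensity (Lp.memLp f) hle⟩

end DensityOfMoments

section ConvolutionPowers

theorem integral_legendre_map_height_convPow (a : SU2) (p n : ℕ) :
    ∫ x, (legendre n).eval x ∂(convPow (orbitalMeasure a) p).map height =
      circleEigenvalue (height a) n ^ p * (legendre n).eval 1 := by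
  induction p with
  | zero =>
    rw [convPow, Measure.map_dirac' measurable_height, height_one, integral_dirac, pow_zero,
      one_mul]
  | succ p ih =>
    have hc := height_mem_Icc a
    rw [map_height_convPow_succ, integral_eval_bind_circleKernel hc (ae_map_height_mem_Icc _),
      circleOp_legendre hc]
    simp only [eval_smul, smul_eq_mul, integral_const_mul]
    rw [ih, pow_succ', mul_assoc]

theorem sq_circleEigenvalue_pow_mul_eval_one_le {c : ℝ} (hc : c ^ 2 < 1) (p : ℕ) {n : ℕ}
    (hn : 0 < n) :
    (circleEigenvalue c n ^ (p + 1) * (legendre n).eval 1) ^ 2 ≤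
      6 / ((1 - c ^ 2) / 2) ^ (p + 1) * (1 / (n : ℝ) ^ p) := by
  set A := (1 - c ^ 2) / 2
  have hA : 0 < A := half_pos (sub_pos.2 hc)
  have hn' : (1 : ℝ) ≤ n := Nat.one_le_cast.2 hn
  have heigenvalue : circleEigenvalue c n ^ 2 ≤ 1 / (n * A) := by
    calc circleEigenvalue c n ^ 2 = |circleEigenvalue c n| ^ 2 := (sq_abs _).symm
      _ ≤ (1 / √(n * A)) ^ 2 := pow_le_pow_left₀ (abs_nonneg _) (abs_circleEigenvalue_le hc hn) 2
      _ = 1 / (n * A) := by rw [div_pow, one_pow, Real.sq_sqrt (by positivity)]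
  calc (circleEigenvalue c n ^ (p + 1) * (legendre n).eval 1) ^ 2
      = (circleEigenvalue c n ^ 2) ^ (p + 1) * (legendre n).eval 1 ^ 2 := by ring
    _ ≤ (1 / (n * A)) ^ (p + 1) * (6 * n) := by
        gcongr
        linarith [eval_one_sq_legendre_le n]
    _ = 6 / A ^ (p + 1) * (1 / (n : ℝ) ^ p) := by
        rw [div_pow, one_pow, mul_pow, pow_succ (n : ℝ)]
        field_simp

theorem summable_sq_circleEigenvalue_pow_mul_eval_one {c : ℝ} (hc : c ^ 2 < 1) {p : ℕ}
    (hp : 3 ≤ p) : Summable fun n => (circleEigenvalue c n ^ p * (legendre n).eval 1) ^ 2 := by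
  obtain ⟨p, rfl⟩ := Nat.exists_eq_succ_of_ne_zero (show p ≠ 0 by lia)
  refine Summable.of_norm_bounded_eventually_nat
    ((Real.summable_one_div_nat_pow.2 (show 1 < p by lia)).mul_left
      (6 / ((1 - c ^ 2) / 2) ^ (p + 1))) ?_
  filter_upwards [Filter.eventually_gt_atTop 0] with n hn
  rw [Real.norm_of_nonneg (sq_nonneg _)]
  exact sq_circleEigenvalue_pow_mul_eval_one_le hc p hn

theorem memLp_density_convPow {a : SU2} (ha : a ∉ Subgroup.normalizer (SO2 : Set SU2)) {p : ℕ}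
    (hp : 3 ≤ p) :
    convPow (orbitalMeasure a) p ≪ haarU ∧
      MemLp (density (convPow (orbitalMeasure a) p)) 2 haarU := by
  have hcoeff : Summable fun n =>
      (∫ x, (legendre n).eval x ∂(convPow (orbitalMeasure a) p).map height) ^ 2 := by
    simpa only [integral_legendre_map_height_convPow] using
      summable_sq_circleEigenvalue_pow_mul_eval_one (sq_height_lt_one ha) hp
  have hinv := isBiInvariant_convPow a (show 1 ≤ p by lia)
  obtain ⟨hac, hmem⟩ :=
    memLp_rnDeriv_uniformMeasure_of_summable (ae_map_height_mem_Icc _) hcoeff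
  rw [← map_height_haarU] at hac hmem
  exact ⟨hinv.absolutelyContinuous hac, (hinv.memLp_density_iff hac).2 hmem⟩

end ConvolutionPowers

section AbsoluteContinuity

theorem volume_image_eq_zero_of_differentiableAt {φ : ℝ → ℝ} {s t : Set ℝ} (ht : t.Countable)
    (hφ : ∀ x ∉ t, DifferentiableAt ℝ φ x) (hs : volume s = 0) : volume (φ '' s) = 0 := by
  have hgood : volume (φ '' (s \ t)) = 0 :=
    addHaar_image_eq_zero_of_differentiableOn_of_addHaar_eq_zero volume
      (fun x hx => (hφ x hx.2).differentiableWithinAt) (measure_mono_null Set.sdiff_subset hs)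
  refine measure_mono_null ?_ (measure_union_null hgood ((ht.image φ).measure_zero volume))
  rw [← Set.image_union, Set.sdiff_union_self]
  exact Set.image_mono Set.subset_union_left

-- The fibres of `cos` are covered by countably many branches of `arccos`.
theorem quasiMeasurePreserving_cos : Measure.QuasiMeasurePreserving Real.cos := by
  refine ⟨Real.measurable_cos, Measure.AbsolutelyContinuous.mk fun s hs hnull => ?_⟩
  rw [Measure.map_apply Real.measurable_cos hs]
  have hcover : Real.cos ⁻¹' s ⊆ ⋃ k : ℤ, (fun y => 2 * k * Real.pi + Real.arccos y) '' s ∪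
      (fun y => 2 * k * Real.pi - Real.arccos y) '' s := by
    intro t ht
    obtain ⟨k, hk⟩ := Real.cos_eq_cos_iff.1
      (Real.cos_arccos (Real.neg_one_le_cos t) (Real.cos_le_one t))
    exact Set.mem_iUnion.2
      ⟨k, hk.imp (fun h => ⟨_, ht, h.symm⟩) (fun h => ⟨_, ht, h.symm⟩)⟩
  have harccos (y : ℝ) (hy : y ∉ ({-1, 1} : Set ℝ)) : DifferentiableAt ℝ Real.arccos y :=
    Real.differentiableAt_arccos.2
      ⟨fun h => hy (Or.inl h), fun h => hy (Or.inr h)⟩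
  have hcount : ({-1, 1} : Set ℝ).Countable := (Set.finite_singleton 1).insert (-1) |>.countable
  exact measure_mono_null hcover (measure_iUnion_null fun k => measure_union_null
    (volume_image_eq_zero_of_differentiableAt hcount (fun y hy => (harccos y hy).const_add _) hnull)
    (volume_image_eq_zero_of_differentiableAt hcount (fun y hy => (harccos y hy).const_sub _)
      hnull))

theorem quasiMeasurePreserving_circleMap {c z : ℝ} (hc : c ^ 2 < 1) (hz : z ^ 2 < 1) :
    Measure.QuasiMeasurePreserving (circleMap c z) := by
  have hradius : √(1 - c ^ 2) * √(1 - z ^ 2) ≠ 0 :=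
    mul_ne_zero (Real.sqrt_pos.2 (sub_pos.2 hc)).ne' (Real.sqrt_pos.2 (sub_pos.2 hz)).ne'
  exact (Measure.measurePreserving_sub_left volume (c * z)).quasiMeasurePreserving.comp
    ((Measure.quasiMeasurePreserving_smul volume hradius).comp
      (quasiMeasurePreserving_cos.comp (Measure.quasiMeasurePreserving_smul volume two_ne_zero)))

theorem angleMeasure_absolutelyContinuous : angleMeasure ≪ volume :=
  Measure.smul_absolutelyContinuous.trans Measure.restrict_le_self.absolutelyContinuous

theorem absolutelyContinuous_uniformMeasure {ν : Measure ℝ} (hac : ν ≪ volume)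
    (hν : ∀ᵐ x ∂ν, x ∈ Set.Icc (-1 : ℝ) 1) : ν ≪ uniformMeasure := by
  have hscale : volume.restrict (Set.Icc (-1 : ℝ) 1) ≪ uniformMeasure := by
    rw [← Measure.restrict_congr_set Ioc_ae_eq_Icc]
    exact Measure.absolutelyContinuous_smul (ENNReal.ofReal_pos.2 (by positivity)).ne'
  rw [← Measure.restrict_eq_self_of_ae_mem hν]
  exact (hac.restrict _).trans hscale

theorem circleKernel_absolutelyContinuous {c z : ℝ} (hc : c ^ 2 < 1) (hz : z ^ 2 < 1) :
    circleKernel c z ≪ uniformMeasure := by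
  have mem_Icc {x : ℝ} (hx : x ^ 2 < 1) : x ∈ Set.Icc (-1 : ℝ) 1 :=
    abs_le.1 ((sq_le_one_iff_abs_le_one x).1 hx.le)
  have hcircle := quasiMeasurePreserving_circleMap hc hz
  exact absolutelyContinuous_uniformMeasure
    ((angleMeasure_absolutelyContinuous.map hcircle.measurable).trans hcircle.absolutelyContinuous)
    (ae_circleKernel_mem_Icc (mem_Icc hc) (mem_Icc hz))

end AbsoluteContinuity

section NotSquareIntegrable

variable {α : Type*} [MeasurableSpace α] {μ : Measure α} [IsFiniteMeasure μ]

theorem sq_integral_le_measureReal_univ_mul_integral_sq {f : α → ℝ} (hf : MemLp f 2 μ) :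
    (∫ x, f x ∂μ) ^ 2 ≤ μ.real Set.univ * ∫ x, f x ^ 2 ∂μ := by
  rcases eq_zero_or_neZero μ with rfl | hμ
  · simp only [integral_zero_measure, ne_eq, OfNat.ofNat_ne_zero, not_false_eq_true, zero_pow,
      mul_zero, le_refl]
  have hpos : 0 < μ.real Set.univ := measureReal_univ_pos
  have hjensen := even_two.convexOn_pow.map_average_le (μ := μ) (f := f)
    (continuous_pow 2).continuousOn isClosed_univ (Filter.Eventually.of_forall fun _ => trivial)
    (hf.integrable one_le_two) hf.integrable_sq
  rw [average_eq, average_eq, smul_eq_mul, smul_eq_mul, inv_mul_eq_div, inv_mul_eq_div, div_pow,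
    div_le_div_iff₀ (by positivity) hpos] at hjensen
  nlinarith

theorem not_memLp_two_toReal_rnDeriv {ν : Measure α} [IsFiniteMeasure ν] (hac : ν ≪ μ)
    {s : ℕ → Set α} (hlim : Filter.Tendsto (μ ∘ s) Filter.atTop (nhds 0))
    (hpos : ∀ n, 0 < μ.real (s n)) {C : ℝ} (hC : 0 < C)
    (hle : ∀ n, C * μ.real (s n) ≤ ν.real (s n) ^ 2) :
    ¬ MemLp (fun x => (ν.rnDeriv μ x).toReal) 2 μ := by
  intro hmem
  have hlower (n : ℕ) : C ≤ ∫ x in s n, (ν.rnDeriv μ x).toReal ^ 2 ∂μ := by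
    have hcs := sq_integral_le_measureReal_univ_mul_integral_sq (hmem.restrict (s n))
    rw [Measure.setIntegral_toReal_rnDeriv hac, measureReal_restrict_apply_univ] at hcs
    exact le_of_mul_le_mul_left (by linarith [hle n]) (hpos n)
  exact hC.not_ge
    (ge_of_tendsto' (hmem.integrable_sq.tendsto_setIntegral_nhds_zero hlim) hlower)

end NotSquareIntegrable

section ConvolutionSquare

theorem measureReal_angleMeasure_Ioo {a b : ℝ} (ha : 0 ≤ a) (hab : a ≤ b) (hb : b ≤ 2 * Real.pi) :
    angleMeasure.real (Set.Ioo a b) = (b - a) / (2 * Real.pi) := by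
  have hsub : Set.Ioo a b ⊆ Set.Ioc 0 (2 * Real.pi) := fun t ht =>
    ⟨ha.trans_lt ht.1, ht.2.le.trans hb⟩
  rw [angleMeasure, measureReal_ennreal_smul_apply, measureReal_restrict_apply measurableSet_Ioo,
    Set.inter_eq_left.2 hsub, Real.volume_real_Ioo_of_le hab,
    ENNReal.toReal_ofReal (by positivity), inv_mul_eq_div]

theorem measureReal_uniformMeasure_Ioi {r : ℝ} (h0 : 0 ≤ r) (h1 : r ≤ 1) :
    uniformMeasure.real (Set.Ioi (1 - 2 * r)) = r := by
  rw [uniformMeasure, measureReal_ennreal_smul_apply, measureReal_restrict_apply measurableSet_Ioi,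
    Set.inter_comm, Set.Ioc_inter_Ioi, max_eq_right (by linarith),
    Real.volume_real_Ioc_of_le (by linarith), ENNReal.toReal_ofReal (by positivity)]
  ring

theorem circleMap_self {c : ℝ} (hc : c ^ 2 ≤ 1) (t : ℝ) :
    circleMap c c t = 1 - 2 * ((1 - c ^ 2) * Real.cos t ^ 2) := by
  rw [circleMap, Real.mul_self_sqrt (sub_nonneg.2 hc), Real.cos_two_mul]
  ring

theorem div_pi_le_measureReal_circleKernel_Ioi {c δ : ℝ} (hc : c ^ 2 ≤ 1) (h0 : 0 < δ)
    (h1 : δ ≤ 1) : δ / Real.pi ≤ (circleKernel c c).real (Set.Ioi (1 - 2 * δ ^ 2)) := by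
  have hpi := Real.pi_gt_three
  have hcos {t : ℝ} (ht : |Real.pi / 2 - t| < δ) : Real.cos t ^ 2 < δ ^ 2 := by
    rw [← Real.sin_pi_div_two_sub]
    exact sq_lt_sq.2 (Real.abs_sin_le_abs.trans_lt (ht.trans_le (le_abs_self δ)))
  have hsub : Set.Ioo (Real.pi / 2 - δ) (Real.pi / 2 + δ) ⊆
      circleMap c c ⁻¹' Set.Ioi (1 - 2 * δ ^ 2) := by
    intro t ht
    have hlt := hcos (t := t) (abs_lt.2 ⟨by linarith [ht.2], by linarith [ht.1]⟩)
    rw [Set.mem_preimage, Set.mem_Ioi, circleMap_self hc]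
    nlinarith [mul_nonneg (sq_nonneg c) (sq_nonneg (Real.cos t))]
  calc δ / Real.pi = angleMeasure.real (Set.Ioo (Real.pi / 2 - δ) (Real.pi / 2 + δ)) := by
        rw [measureReal_angleMeasure_Ioo (by linarith) (by linarith) (by linarith)]
        field_simp
        ring
    _ ≤ angleMeasure.real (circleMap c c ⁻¹' Set.Ioi (1 - 2 * δ ^ 2)) := measureReal_mono hsub
    _ = (circleKernel c c).real (Set.Ioi (1 - 2 * δ ^ 2)) :=
        (map_measureReal_apply (continuous_circleMap c c).measurable measurableSet_Ioi).symm

-- A cap of measure `δ ^ 2` has mass at least `δ / π`, which no `L²` density allows as `δ → 0`.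
theorem not_memLp_rnDeriv_circleKernel_self {c : ℝ} (hc : c ^ 2 < 1) :
    ¬ MemLp (fun x => ((circleKernel c c).rnDeriv uniformMeasure x).toReal) 2 uniformMeasure := by
  let δ (n : ℕ) : ℝ := 1 / (n + 1)
  have hδ_pos (n : ℕ) : 0 < δ n := Nat.one_div_pos_of_nat
  have hδ_le (n : ℕ) : δ n ≤ 1 := (div_le_one (by positivity)).2 (by simp)
  have hcap (n : ℕ) : uniformMeasure.real (Set.Ioi (1 - 2 * δ n ^ 2)) = δ n ^ 2 :=
    measureReal_uniformMeasure_Ioi (sq_nonneg _) (pow_le_one₀ (hδ_pos n).le (hδ_le n))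
  have hlim : Filter.Tendsto (fun n => δ n ^ 2) Filter.atTop (nhds 0) := by
    simpa only [zero_pow two_ne_zero] using (tendsto_one_div_add_atTop_nhds_zero_nat (𝕜 := ℝ)).pow 2
  refine not_memLp_two_toReal_rnDeriv (circleKernel_absolutelyContinuous hc hc)
    (s := fun n => Set.Ioi (1 - 2 * δ n ^ 2)) (C := (1 / Real.pi) ^ 2) ?_ (fun n => ?_)
    (by positivity) fun n => ?_
  · refine (ENNReal.tendsto_toReal_iff (fun _ => measure_ne_top _ _) ENNReal.zero_ne_top).1 ?_
    exact hlim.congr fun n => (hcap n).symm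
  · rw [hcap]
    exact pow_pos (hδ_pos n) 2
  · calc (1 / Real.pi) ^ 2 * uniformMeasure.real (Set.Ioi (1 - 2 * δ n ^ 2))
        = (δ n / Real.pi) ^ 2 := by rw [hcap]; ring
      _ ≤ (circleKernel c c).real (Set.Ioi (1 - 2 * δ n ^ 2)) ^ 2 :=
        pow_le_pow_left₀ (div_nonneg (hδ_pos n).le Real.pi_pos.le)
          (div_pi_le_measureReal_circleKernel_Ioi hc.le (hδ_pos n) (hδ_le n)) 2

theorem convPow_two_absolutelyContinuous_not_memLp_density {a : SU2}
    (ha : a ∉ Subgroup.normalizer (SO2 : Set SU2)) :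
    convPow (orbitalMeasure a) 2 ≪ haarU ∧
      ¬ MemLp (density (convPow (orbitalMeasure a) 2)) 2 haarU := by
  have hc := sq_height_lt_one ha
  have hinv := isBiInvariant_convPow a one_le_two
  have hac : (convPow (orbitalMeasure a) 2).map height ≪ haarU.map height := by
    rw [map_height_haarU, map_height_convPow_two]
    exact circleKernel_absolutelyContinuous hc hc
  refine ⟨hinv.absolutelyContinuous hac, ?_⟩
  rw [hinv.memLp_density_iff hac, map_height_haarU, map_height_convPow_two]
  exact not_memLp_rnDeriv_circleKernel_self hc

theorem diagElement_notMem_normalizer_SO2 {θ : ℝ}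
    (hθ : θ ∈ Set.Ioo (Real.pi / 12) (5 * Real.pi / 12)) :
    diagElement θ ∉ Subgroup.normalizer (SO2 : Set SU2) := by
  have := Real.pi_pos
  rw [diagElement_mem_normalizer_SO2_iff]
  exact (Real.sin_pos_of_pos_of_lt_pi (by linarith [hθ.1]) (by linarith [hθ.2])).ne'

end ConvolutionSquare

end OrbitalSU2

open OrbitalSU2 in
theorem theorem1_general {a : SU2} (ha : a ∉ Subgroup.normalizer (SO2 : Set SU2)) :
    (∀ p : ℕ, 3 ≤ p →
      convPow (orbitalMeasure a) p ≪ haarU ∧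
        MemLp (density (convPow (orbitalMeasure a) p)) 2 haarU) ∧
    convPow (orbitalMeasure a) 2 ≪ haarU ∧
    ¬ MemLp (density (convPow (orbitalMeasure a) 2)) 2 haarU :=
  ⟨fun _ hp => memLp_density_convPow ha hp, convPow_two_absolutelyContinuous_not_memLp_density ha⟩

open OrbitalSU2 in
theorem theorem1 :
    (∀ a : SU2, a ∉ Subgroup.normalizer (SO2 : Set SU2) → ∀ p : ℕ, 3 ≤ p →
      convPow (orbitalMeasure a) p ≪ haarU ∧
        MemLp (density (convPow (orbitalMeasure a) p)) 2 haarU) ∧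
    (∀ θ : ℝ, θ ∈ Set.Ioo (Real.pi / 12) (5 * Real.pi / 12) →
      diagElement θ ∉ Subgroup.normalizer (SO2 : Set SU2) ∧
        convPow (orbitalMeasure (diagElement θ)) 2 ≪ haarU ∧
        ¬ MemLp (density (convPow (orbitalMeasure (diagElement θ)) 2)) 2 haarU) ∧
    ¬ (∀ a : SU2, a ∉ Subgroup.normalizer (SO2 : Set SU2) → ∀ p : ℕ, 1 ≤ p →
      (convPow (orbitalMeasure a) p ≪ haarU ↔
        convPow (orbitalMeasure a) p ≪ haarU ∧
          MemLp (density (convPow (orbitalMeasure a) p)) 2 haarU)) := by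
  refine ⟨fun a ha => (theorem1_general ha).1,
    fun θ hθ => ⟨diagElement_notMem_normalizer_SO2 hθ,
      (theorem1_general (diagElement_notMem_normalizer_SO2 hθ)).2⟩, fun h => ?_⟩
  have hpi := Real.pi_pos
  have ha := diagElement_notMem_normalizer_SO2 (θ := Real.pi / 4) ⟨by linarith, by linarith⟩
  obtain ⟨-, hac, hL⟩ := theorem1_general ha
  exact hL ((h _ ha 2 one_le_two).1 hac).2
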